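/- **Proposition 1.3 (Kelvin transform for the logarithmic Laplacian).** *Notation.* Let $N\ge 1$, $c_N=\pi^{-N/2}\Gamma(\frac N2)$, $\rho_N=2\ln 2+\Psi(\frac N2)-\gamma$ with $\Psi=\Gamma'/\Gamma$ and $\gamma$ the Euler–Mascheroni constant, and let $B_r(x)$ be the open ball. The logarithmic Laplacian is $$L_\Delta u(x)=c_N\int_{B_1(x)}\frac{u(x)-u(y)}{|x-y|^N}\,dy-c_N\int_{\mathbb R^N\setminus B_1(x)}\frac{u(y)}{|x-y|^N}\,dy+\rho_N u(x),$$ and it is *well defined at $x$* if both integrals converge absolutely. For $\Omega\subset\mathbb R^N$, $$h_\Omega(x)=c_N\Big(\int_{B_1(x)\setminus\Omega}|x-y|^{-N}dy-\int_{\Omega\setminus B_1(x)}|x-y|^{-N}dy\Big).$$ A function $v:\mathbb R^N\to\mathbb R$ is *Dini continuous at $x$* if $\omega_{v,x}(r)=\sup_{|y-x|\le r}|v(y)-v(x)|$ is finite for every $r>0$ and $\int_0^1\frac{\omega_{v,x}(r)}r\,dr<\infty$. The space $\mathbb H(\Omega)$ consists of all $u\in L^2(\mathbb R^N)$ with $u=0$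 a.e. in $\mathbb R^N\setminus\Omega$ and $\iint_{|x-y|\le1}\frac{|u(x)-u(y)|^2}{|x-y|^N}\,dx\,dy<\infty$. For $x_0\in\mathbb R^N$ and $R>0$ put $x^*=x_0+R^2\frac{x-x_0}{|x-x_0|^2}$ for $x\ne x_0$, $\Omega^*=\{x^*:x\in\Omega\setminus\{x_0\}\}$, and let $u^*$ be given by $u^*(x^*)=|x^*-x_0|^{-N}u(x)$ for $x\neq x_0$ and $u^*(x_0)=0$. *Statement.* Let $x_0\in\mathbb R^N$, $R>0$, let $\Omega\subset\mathbb R^N$ be open and bounded, and let $u:\mathbb R^N\to\mathbb R$ be Lebesgue measurable with $u=0$ on $\mathbb R^N\setminus\Omega$. i) Let $x\ne x_0$. If $u$ is Dini continuous at $x$, then $u^*$ is Dini continuous at $x^*$ and $L_\Delta u$ is well defined at $x$. Whenever $L_\Delta u$ is well defined at $x$ (in particular if $u$ is Dini continuous at $x$), $L_\Delta u^*$ is well defined at $x^*$, and if $x_0\notin\overline\Omega$ or $u(x)=0$, then $$L_\Delta u^*(x^*)=|x^*-x_0|^{-N}L_\Delta u(x)+c_N\frac{R^{2N}}{|x^*-x_0|^{2N}}\,u(x)\int_\Omega\frac{|z-x_0|^{-N}-|x-x_0|^{-N}}{|z-x|^N}\,dz+\big(h_{\Omega^*}(x^*)-h_\Omega(x)\big)|x^*-x_0|^{-N}u(x),$$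 where the last two terms are read as $0$ if $u(x)=0$. If $x_0\notin\overline\Omega$, the integral over $\Omega$ in this formula converges absolutely, and if moreover $x\in\Omega$, the integrals defining $h_\Omega(x)$ and $h_{\Omega^*}(x^*)$ converge. ii) If $B_R(x_0)\subset\mathbb R^N\setminus\Omega$, $u\in L^\infty(\Omega)$, and $L_\Delta u$ is well defined a.e. in $\Omega$ with $L_\Delta u\in L^\infty(\Omega)$, then $u^*\in L^\infty(\Omega^*)$, and $L_\Delta u^*$ is well defined a.e. in $\Omega^*$ with $L_\Delta u^*\in L^\infty(\Omega^*)$. iii) If $B_R(x_0)\subset\mathbb R^N\setminus\Omega$ and $u\in\mathbb H(\Omega)$, then $u^*\in\mathbb H(\Omega^*)$. -/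

import Mathlib

open MeasureTheory Set Metric
open scoped ENNReal

noncomputable section

/-- The constant `c_N = π ^ (-N/2) Γ(N/2)`. -/
def logLapC (N : ℕ) : ℝ :=
  Real.pi ^ (-(N : ℝ) / 2) * Real.Gamma ((N : ℝ) / 2)

/-- The constant `ρ_N = 2 ln 2 + Ψ(N/2) - γ`, where `Ψ = Γ'/Γ` is the digamma function and `γ` is
the Euler-Mascheroni constant. -/
def logLapRho (N : ℕ) : ℝ :=
  2 * Real.log 2 + deriv Real.Gamma ((N : ℝ) / 2) / Real.Gamma ((N : ℝ) / 2)
    - Real.eulerMascheroniConstant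

/-- The logarithmic Laplacian of `u` at the point `x`, through its integral representation. -/
def logLaplacian {N : ℕ} (u : EuclideanSpace ℝ (Fin N) → ℝ) (x : EuclideanSpace ℝ (Fin N)) : ℝ :=
  logLapC N * (∫ y in ball x 1, (u x - u y) / ‖x - y‖ ^ N)
    - logLapC N * (∫ y in (ball x 1)ᶜ, u y / ‖x - y‖ ^ N)
    + logLapRho N * u x

/-- Both integrals in the integral representation of the logarithmic Laplacian of `u` at `x`
converge absolutely. -/
def LogLaplacianDefinedAt {N : ℕ} (u : EuclideanSpace ℝ (Fin N) → ℝ)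
    (x : EuclideanSpace ℝ (Fin N)) : Prop :=
  IntegrableOn (fun y => (u x - u y) / ‖x - y‖ ^ N) (ball x 1) ∧
    IntegrableOn (fun y => u y / ‖x - y‖ ^ N) (ball x 1)ᶜ

/-- The function `h_Ω`. -/
def hFun {N : ℕ} (Ω : Set (EuclideanSpace ℝ (Fin N))) (x : EuclideanSpace ℝ (Fin N)) : ℝ :=
  logLapC N * ((∫ y in ball x 1 \ Ω, 1 / ‖x - y‖ ^ N) - ∫ y in Ω \ ball x 1, 1 / ‖x - y‖ ^ N)

/-- Both integrals in the definition of `h_Ω(x)` converge. -/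
def HFunDefinedAt {N : ℕ} (Ω : Set (EuclideanSpace ℝ (Fin N)))
    (x : EuclideanSpace ℝ (Fin N)) : Prop :=
  IntegrableOn (fun y => 1 / ‖x - y‖ ^ N) (ball x 1 \ Ω) ∧
    IntegrableOn (fun y => 1 / ‖x - y‖ ^ N) (Ω \ ball x 1)

/-- The modulus of continuity of `v` at `x` relative to the set `E`,
`ω_{v,x,E}(r) = sup {|v y - v x| : y ∈ E, |y - x| ≤ r}`, as an extended nonnegative number. -/
def modulusAt {N : ℕ} (v : EuclideanSpace ℝ (Fin N) → ℝ) (x : EuclideanSpace ℝ (Fin N))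
    (E : Set (EuclideanSpace ℝ (Fin N))) (r : ℝ) : ℝ≥0∞ :=
  ⨆ y ∈ E ∩ closedBall x r, ENNReal.ofReal |v y - v x|

/-- Dini continuity of `v` at `x` relative to `E`: the modulus of continuity is a function
`(0, ∞) → [0, ∞)` (that is, it takes finite values only) and `∫_0^1 ω_{v,x,E}(r) / r dr < ∞`. -/
def DiniContinuousAt {N : ℕ} (v : EuclideanSpace ℝ (Fin N) → ℝ)
    (E : Set (EuclideanSpace ℝ (Fin N))) (x : EuclideanSpace ℝ (Fin N)) : Prop :=
  (∀ r : ℝ, 0 < r → modulusAt v x E r < ∞) ∧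
    ∫⁻ r in Ioo (0 : ℝ) 1, modulusAt v x E r / ENNReal.ofReal r < ∞

/-- Membership in the space `ℍ(Ω)`. -/
def MemH {N : ℕ} (Ω : Set (EuclideanSpace ℝ (Fin N))) (u : EuclideanSpace ℝ (Fin N) → ℝ) : Prop :=
  MemLp u 2 volume ∧
    ∫⁻ x, ∫⁻ y in closedBall x 1, ENNReal.ofReal (|u x - u y| ^ 2 / ‖x - y‖ ^ N) < ∞ ∧
    ∀ᵐ x, x ∉ Ω → u x = 0

/-- The Kelvin transform `u*` of `u` with respect to the sphere `S_R(x₀)`: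
`u*(y) = |y - x₀| ^ (-N) u(y*)` for `y ≠ x₀`, where `y*` is the inversion of `y`. Since the
inversion is an involution off `x₀`, this says `u*(x*) = |x* - x₀| ^ (-N) u(x)`.
(At `y = x₀` the value is `0` when `N ≥ 1`.) -/
def kelvin {N : ℕ} (x₀ : EuclideanSpace ℝ (Fin N)) (R : ℝ) (u : EuclideanSpace ℝ (Fin N) → ℝ)
    (y : EuclideanSpace ℝ (Fin N)) : ℝ :=
  (‖y - x₀‖ ^ N)⁻¹ * u (EuclideanGeometry.inversion x₀ R y)

/-- The set `Ω* = {x* : x ∈ Ω, x ≠ x₀}`. -/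
def kelvinSet {N : ℕ} (x₀ : EuclideanSpace ℝ (Fin N)) (R : ℝ)
    (Ω : Set (EuclideanSpace ℝ (Fin N))) : Set (EuclideanSpace ℝ (Fin N)) :=
  EuclideanGeometry.inversion x₀ R '' (Ω \ {x₀})

end

/-! Write `x*` for the inversion of `x`. Two facts drive everything: `|x* - z*| = R² |x - z| / (|x -
x₀| |z - x₀|)`, and the inversion has Jacobian `(R / |z - x₀|) ^ (2N)`. Substituting `y = z*` in an
integral against `|x* - y| ^ (-N)`, the weight in the Kelvin transform exactly absorbs the factors
attached to `u z`, leaving `|x* - x₀| ^ (-N) u z / |x - z| ^ N`. The term with `u x` does not match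
exactly: it leaves `u x` times a correction whose numerator `|z - x₀| ^ (-N) - |x - x₀| ^ (-N)`
vanishes at `z = x`. Away from `x₀` it is Lipschitz, so the correction has only an integrable
singularity of order `|z - x| ^ (1 - N)`. This is `jacobian_mul_logLapIntegrand_kelvin`.

The unit ball is not invariant under inversion, so it is first replaced by a bounded neighbourhood
`D` of `x` away from `x₀`. The price is `u x` times the integral of a difference of kernels, which
is bounded and vanishes near `x`. `logLaplacian_kelvin` combines both changes of set with the
substitution. Taking `D = Ω` gives the stated formula, the kernel differences being `h_Ω` and
`h_Ω*`; taking small balls gives well-definedness and, with uniform constants, the bound in (ii).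
All corrections carry the factor `u x`, so they disappear when `u x = 0`; otherwise `x ∈ Ω`.

Dini continuity and the energy bound in (iii) both rest on `p s - q t = p (s - t) + (p - q) t`, with
`p`, `q` the Kelvin weights and `s`, `t` values of `u`. The first term is transported by the
inversion; the second is controlled by the Lipschitz bound on the weights. -/

open EuclideanGeometry

/-! ### Inversion as a change of variables -/

section ChangeOfVariables

variable {N : ℕ} {x₀ : EuclideanSpace ℝ (Fin N)} {R : ℝ}

theorem abs_det_fderiv_inversion (x : EuclideanSpace ℝ (Fin N)) :
    |((R / dist x x₀) ^ 2 • ((Submodule.span ℝ {x - x₀})ᗮ.reflection :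
      EuclideanSpace ℝ (Fin N) →L[ℝ] EuclideanSpace ℝ (Fin N))).det| =
      (R / dist x x₀) ^ (2 * N) := by
  have h : |((Submodule.span ℝ {x - x₀})ᗮ.reflection :
      EuclideanSpace ℝ (Fin N) →L[ℝ] EuclideanSpace ℝ (Fin N)).det| = 1 := by
    have := Submodule.det_reflection (Submodule.span ℝ {x - x₀})ᗮ
    rw [ContinuousLinearMap.det]
    erw [this]
    simp
  rw [ContinuousLinearMap.det] at h ⊢
  rw [ContinuousLinearMap.toLinearMap_smul, LinearMap.det_smul, abs_mul, h]
  simp [pow_mul]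

theorem inversion_image_compl_center (hR : 0 < R) : inversion x₀ R '' {x₀}ᶜ = {x₀}ᶜ := by
  rw [image_compl_eq (inversion_bijective x₀ hR.ne'), image_singleton, inversion_self]

theorem hasFDerivWithinAt_inversion_compl (x : EuclideanSpace ℝ (Fin N))
    (hx : x ∈ ({x₀}ᶜ : Set _)) :
    HasFDerivWithinAt (inversion x₀ R) ((R / dist x x₀) ^ 2 •
      ((Submodule.span ℝ {x - x₀})ᗮ.reflection :
        EuclideanSpace ℝ (Fin N) →L[ℝ] EuclideanSpace ℝ (Fin N))) {x₀}ᶜ x :=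
  (hasFDerivAt_inversion hx).hasFDerivWithinAt

variable [NeZero N]

theorem lintegral_inversion (hR : 0 < R) (f : EuclideanSpace ℝ (Fin N) → ℝ≥0∞) :
    ∫⁻ z, ENNReal.ofReal ((R / dist z x₀) ^ (2 * N)) * f (inversion x₀ R z) = ∫⁻ y, f y := by
  have := lintegral_image_eq_lintegral_abs_det_fderiv_mul volume
    (measurableSet_singleton x₀).compl hasFDerivWithinAt_inversion_compl
    ((inversion_injective x₀ hR.ne').injOn) f
  simp only [abs_det_fderiv_inversion, inversion_image_compl_center hR,
    restrict_compl_singleton] at this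
  exact this.symm

theorem integrable_inversion_iff (hR : 0 < R) (f : EuclideanSpace ℝ (Fin N) → ℝ) :
    Integrable (fun z => (R / dist z x₀) ^ (2 * N) * f (inversion x₀ R z)) ↔ Integrable f := by
  have := integrableOn_image_iff_integrableOn_abs_det_fderiv_smul volume
    (measurableSet_singleton x₀).compl hasFDerivWithinAt_inversion_compl
    ((inversion_injective x₀ hR.ne').injOn) f
  simp only [abs_det_fderiv_inversion, inversion_image_compl_center hR,
    restrict_compl_singleton, IntegrableOn, smul_eq_mul] at this
  exact this.symm

theorem integral_inversion (hR : 0 < R) (f : EuclideanSpace ℝ (Fin N) → ℝ) :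
    ∫ z, (R / dist z x₀) ^ (2 * N) * f (inversion x₀ R z) = ∫ y, f y := by
  have := integral_image_eq_integral_abs_det_fderiv_smul volume
    (measurableSet_singleton x₀).compl hasFDerivWithinAt_inversion_compl
    ((inversion_injective x₀ hR.ne').injOn) f
  simp only [abs_det_fderiv_inversion, inversion_image_compl_center hR,
    restrict_compl_singleton, smul_eq_mul] at this
  exact this.symm

omit [NeZero N] in
theorem measurable_inversion : Measurable (inversion x₀ R) := by
  unfold inversion
  simp only [vsub_eq_sub, vadd_eq_add]
  fun_prop

/-- Applying the change of variables to the indicator of the preimage of a null set `s` gives, since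
the inversion is an involution, the Jacobian times the indicator of `s`. This lets almost-everywhere
statements pass through the inversion. -/
theorem quasiMeasurePreserving_inversion (hR : 0 < R) :
    Measure.QuasiMeasurePreserving (inversion x₀ R) volume volume := by
  refine ⟨measurable_inversion, Measure.AbsolutelyContinuous.mk fun s hs h0 => ?_⟩
  rw [Measure.map_apply measurable_inversion hs,
    ← lintegral_indicator_one (measurable_inversion hs), ← lintegral_inversion hR (x₀ := x₀),
    lintegral_eq_zero_iff' ?_]
  · have : ∀ᵐ z : EuclideanSpace ℝ (Fin N), z ∉ s := by
      rw [ae_iff]; simpa using h0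
    filter_upwards [this] with z hz
    simp [indicator, inversion_inversion x₀ hR.ne', hz]
  · refine AEMeasurable.mul (by fun_prop) (Measurable.aemeasurable ?_)
    exact (measurable_one.indicator (measurable_inversion hs)).comp measurable_inversion

theorem ae_inversion (hR : 0 < R) {p : EuclideanSpace ℝ (Fin N) → Prop}
    (h : ∀ᵐ x, p x) : ∀ᵐ y, p (inversion x₀ R y) :=
  (quasiMeasurePreserving_inversion hR).ae h

end ChangeOfVariables

/-! ### Integrability of the kernels -/

section KernelIntegrability

variable {N : ℕ} [NeZero N]

theorem integrableOn_ball_comp_norm_sub {f : ℝ → ℝ} {r : ℝ} (x : EuclideanSpace ℝ (Fin N))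
    (hf : IntegrableOn (fun t => t ^ (N - 1) * f t) (Ioo 0 r)) :
    IntegrableOn (fun z => f ‖z - x‖) (ball x r) := by
  have h := (integrableOn_fun_norm_addHaar (E := EuclideanSpace ℝ (Fin N)) volume (f := f)
    (r := r)).2 (by simpa using hf)
  rw [← integrable_indicator_iff measurableSet_ball] at h ⊢
  refine (h.comp_sub_right x).congr (.of_forall fun z => ?_)
  simp [indicator, dist_eq_norm]

/-- In polar coordinates the weight `t ^ (N - 1)` turns `t / t ^ N` into the constant `1`. -/
theorem integrableOn_ball_norm_div_pow (x : EuclideanSpace ℝ (Fin N)) (r : ℝ) :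
    IntegrableOn (fun z => ‖z - x‖ / ‖z - x‖ ^ N) (ball x r) := by
  refine integrableOn_ball_comp_norm_sub (f := fun t => t / t ^ N) x ?_
  refine IntegrableOn.congr_fun (f := fun _ => (1 : ℝ)) (by simp) ?_ measurableSet_Ioo
  intro t ht
  have hN : N = N - 1 + 1 := (Nat.succ_pred (NeZero.ne N)).symm
  have : t ≠ 0 := ht.1.ne'
  beta_reduce
  rw [← mul_div_assoc, ← pow_succ, ← hN, div_self (pow_ne_zero _ this)]

/-- The integral of `|z| / |z| ^ N` over the ball of radius `r`. -/
noncomputable def kernelMass (N : ℕ) (r : ℝ) : ℝ :=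
  ∫ z in ball (0 : EuclideanSpace ℝ (Fin N)) r, ‖z‖ / ‖z‖ ^ N

omit [NeZero N] in
theorem setIntegral_ball_norm_div_pow (x : EuclideanSpace ℝ (Fin N)) (r : ℝ) :
    ∫ z in ball x r, ‖z - x‖ / ‖z - x‖ ^ N = kernelMass N r := by
  rw [kernelMass, ← integral_indicator measurableSet_ball, ← integral_indicator measurableSet_ball,
    ← integral_sub_right_eq_self ((ball (0 : EuclideanSpace ℝ (Fin N)) r).indicator _) x]
  congr 1 with z
  simp [indicator, dist_eq_norm]

omit [NeZero N] in
theorem integrableOn_inv_pow_of_disjoint_ball {x : EuclideanSpace ℝ (Fin N)}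
    {s : Set (EuclideanSpace ℝ (Fin N))} (hs : Bornology.IsBounded s) (hm : MeasurableSet s)
    {δ : ℝ} (hδ : 0 < δ) (h : ∀ y ∈ s, δ ≤ ‖x - y‖) :
    IntegrableOn (fun y => 1 / ‖x - y‖ ^ N) s := by
  refine Measure.integrableOn_of_bounded (M := 1 / δ ^ N) hs.measure_lt_top.ne
    (Measurable.aestronglyMeasurable (by fun_prop)) ?_
  filter_upwards [ae_restrict_mem hm] with y hy
  rw [Real.norm_of_nonneg (by positivity)]
  have := h y hy
  gcongr

end KernelIntegrability

/-! ### Replacing the unit ball by another neighbourhood -/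

section Integrand

variable {N : ℕ}

/-- The integrand of the logarithmic Laplacian of `u` at `x`, with the set `A` in place of the unit
ball around `x`. -/
noncomputable def logLapIntegrand (A : Set (EuclideanSpace ℝ (Fin N)))
    (u : EuclideanSpace ℝ (Fin N) → ℝ) (x y : EuclideanSpace ℝ (Fin N)) : ℝ :=
  (A.indicator (fun _ => u x) y - u y) / ‖x - y‖ ^ N

/-- The difference of the kernels of two sets. -/
noncomputable def kernelDiff (A B : Set (EuclideanSpace ℝ (Fin N)))
    (x y : EuclideanSpace ℝ (Fin N)) : ℝ :=
  (A.indicator (fun _ => 1) y - B.indicator (fun _ => 1) y) / ‖x - y‖ ^ N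

variable {u : EuclideanSpace ℝ (Fin N) → ℝ} {x : EuclideanSpace ℝ (Fin N)}
  {A B : Set (EuclideanSpace ℝ (Fin N))}

theorem logLapIntegrand_eq_add_kernelDiff (A B : Set (EuclideanSpace ℝ (Fin N)))
    (x y : EuclideanSpace ℝ (Fin N)) :
    logLapIntegrand A u x y = logLapIntegrand B u x y + u x * kernelDiff A B x y := by
  simp only [logLapIntegrand, kernelDiff, indicator]
  split_ifs <;> ring

theorem logLapIntegrand_eqOn_ball :
    EqOn (fun y => (u x - u y) / ‖x - y‖ ^ N) (logLapIntegrand (ball x 1) u x) (ball x 1) :=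
  fun y hy => by simp only [logLapIntegrand, indicator_of_mem hy]

theorem logLapIntegrand_eqOn_compl :
    EqOn (fun y => -(u y / ‖x - y‖ ^ N)) (logLapIntegrand (ball x 1) u x) (ball x 1)ᶜ :=
  fun y hy => by simp only [logLapIntegrand, indicator_of_notMem hy]; ring

theorem logLaplacianDefinedAt_iff :
    LogLaplacianDefinedAt u x ↔ Integrable (logLapIntegrand (ball x 1) u x) := by
  rw [← integrableOn_univ, ← union_compl_self (ball x 1), integrableOn_union,
    ← integrableOn_congr_fun logLapIntegrand_eqOn_ball measurableSet_ball,
    ← integrableOn_congr_fun logLapIntegrand_eqOn_compl measurableSet_ball.compl]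
  exact and_congr Iff.rfl integrable_neg_iff.symm

theorem logLaplacian_eq (h : LogLaplacianDefinedAt u x) :
    logLaplacian u x =
      logLapC N * (∫ y, logLapIntegrand (ball x 1) u x y) + logLapRho N * u x := by
  rw [← integral_add_compl (measurableSet_ball (x := x) (ε := 1)) (logLaplacianDefinedAt_iff.1 h),
    ← setIntegral_congr_fun measurableSet_ball logLapIntegrand_eqOn_ball,
    ← setIntegral_congr_fun measurableSet_ball.compl logLapIntegrand_eqOn_compl,
    integral_neg, logLaplacian]
  ring

theorem kernelDiff_eq_indicator (A B : Set (EuclideanSpace ℝ (Fin N)))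
    (x y : EuclideanSpace ℝ (Fin N)) :
    kernelDiff A B x y = (A \ B).indicator (fun y => 1 / ‖x - y‖ ^ N) y -
      (B \ A).indicator (fun y => 1 / ‖x - y‖ ^ N) y := by
  by_cases h1 : y ∈ A <;> by_cases h2 : y ∈ B <;>
    simp [kernelDiff, indicator, h1, h2, neg_div]

theorem integrableOn_inv_pow_diff (hA : MeasurableSet A) (hAb : Bornology.IsBounded A)
    (hB : MeasurableSet B) {ε : ℝ} (hε : 0 < ε) (hxB : ball x ε ⊆ B) :
    IntegrableOn (fun y => 1 / ‖x - y‖ ^ N) (A \ B) := by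
  refine integrableOn_inv_pow_of_disjoint_ball (hAb.subset sdiff_subset) (hA.diff hB) hε ?_
  intro y hy
  by_contra hlt
  exact hy.2 (hxB (by rwa [mem_ball', dist_eq_norm, ← not_le]))

theorem integrable_kernelDiff (hA : MeasurableSet A) (hAb : Bornology.IsBounded A)
    (hB : MeasurableSet B) (hBb : Bornology.IsBounded B) {ε : ℝ} (hε : 0 < ε)
    (hxA : ball x ε ⊆ A) (hxB : ball x ε ⊆ B) : Integrable (kernelDiff A B x) := by
  have := ((integrable_indicator_iff (hA.diff hB)).2
    (integrableOn_inv_pow_diff hA hAb hB hε hxB)).sub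
    ((integrable_indicator_iff (hB.diff hA)).2 (integrableOn_inv_pow_diff hB hBb hA hε hxA))
  exact this.congr (.of_forall fun y => (kernelDiff_eq_indicator A B x y).symm)

theorem hFun_eq_integral_kernelDiff (hA : MeasurableSet A) (hAb : Bornology.IsBounded A)
    {ε : ℝ} (hε : 0 < ε) (hε1 : ε ≤ 1) (hxA : ball x ε ⊆ A) :
    hFun A x = logLapC N * ∫ y, kernelDiff (ball x 1) A x y := by
  have hB := ball_subset_ball (x := x) hε1
  simp only [kernelDiff_eq_indicator]
  rw [integral_sub, integral_indicator (measurableSet_ball.diff hA),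
    integral_indicator (hA.diff measurableSet_ball), hFun]
  · exact (integrable_indicator_iff (measurableSet_ball.diff hA)).2
      (integrableOn_inv_pow_diff measurableSet_ball isBounded_ball hA hε hxA)
  · exact (integrable_indicator_iff (hA.diff measurableSet_ball)).2
      (integrableOn_inv_pow_diff hA hAb measurableSet_ball hε hB)

/-- The integrand vanishes within `ε` of `x` and outside `ball x C`, and is at most `1 / ε ^ N` in
between. The bound depends only on `ε` and `C`, which gives the uniformity needed in (ii). -/
theorem abs_integral_kernelDiff_le {ε C : ℝ} (hε : 0 < ε)
    (hxA : ball x ε ⊆ A) (hxB : ball x ε ⊆ B) (hA : A ⊆ ball x C) (hB : B ⊆ ball x C) :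
    |∫ y, kernelDiff A B x y| ≤
      1 / ε ^ N * volume.real (ball (0 : EuclideanSpace ℝ (Fin N)) C) := by
  have hzero : ∀ y ∉ ball x C, kernelDiff A B x y = 0 := fun y hy => by
    have h1 : y ∉ A := fun h => hy (hA h)
    have h2 : y ∉ B := fun h => hy (hB h)
    simp [kernelDiff, indicator, h1, h2]
  rw [← setIntegral_eq_integral_of_forall_compl_eq_zero hzero]
  have := norm_setIntegral_le_of_norm_le_const (μ := volume) (s := ball x C)
    (f := kernelDiff A B x) (C := 1 / ε ^ N) measure_ball_lt_top (fun y _ => ?_)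
  · have hv : volume.real (ball x C) = volume.real (ball (0 : EuclideanSpace ℝ (Fin N)) C) := by
      simp only [Measure.real, Measure.addHaar_ball_center]
    rwa [hv] at this
  · by_cases h : ‖x - y‖ < ε
    · have hy : y ∈ ball x ε := by rwa [mem_ball', dist_eq_norm]
      have h1 := hxA hy
      have h2 := hxB hy
      simp only [kernelDiff, indicator, h1, h2, if_true, sub_self, zero_div, norm_zero]
      positivity
    · rw [kernelDiff, norm_div, Real.norm_of_nonneg (by positivity : 0 ≤ ‖x - y‖ ^ N)]
      have : ε ≤ ‖x - y‖ := not_lt.1 h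
      have h1 : ‖A.indicator (fun _ => (1 : ℝ)) y - B.indicator (fun _ => 1) y‖ ≤ 1 := by
        by_cases h1 : y ∈ A <;> by_cases h2 : y ∈ B <;> simp [indicator, h1, h2]
      gcongr

end Integrand

/-! ### Lipschitz weights and the correction integral -/

section Lipschitz

theorem abs_inv_pow_sub_inv_pow_le (N : ℕ) {δ a b : ℝ} (hδ : 0 < δ) (ha : δ ≤ a) (hb : δ ≤ b) :
    |(a ^ N)⁻¹ - (b ^ N)⁻¹| ≤ N * δ⁻¹ ^ (N - 1) * (δ⁻¹ * δ⁻¹) * |a - b| := by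
  have ha0 : 0 < a := hδ.trans_le ha
  have hb0 : 0 < b := hδ.trans_le hb
  have h1 : a⁻¹ ≤ δ⁻¹ := by gcongr
  have h2 : b⁻¹ ≤ δ⁻¹ := by gcongr
  have h3 : |a⁻¹ - b⁻¹| ≤ δ⁻¹ * δ⁻¹ * |a - b| := by
    rw [inv_sub_inv ha0.ne' hb0.ne', abs_div, abs_of_pos (mul_pos ha0 hb0), abs_sub_comm b a,
      div_eq_inv_mul, mul_inv]
    gcongr
  rw [← inv_pow, ← inv_pow]
  calc |a⁻¹ ^ N - b⁻¹ ^ N| ≤ |a⁻¹ - b⁻¹| * N * max |a⁻¹| |b⁻¹| ^ (N - 1) := abs_pow_sub_pow_le ..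
    _ ≤ (δ⁻¹ * δ⁻¹ * |a - b|) * N * δ⁻¹ ^ (N - 1) := by
        have : max |a⁻¹| |b⁻¹| ≤ δ⁻¹ := by
          rw [abs_of_pos (inv_pos.2 ha0), abs_of_pos (inv_pos.2 hb0)]; exact max_le h1 h2
        gcongr
    _ = _ := by ring

/-- The Lipschitz constant of `t ↦ t ^ (-N)` on `[δ, ∞)`. -/
noncomputable def invPowLip (N : ℕ) (δ : ℝ) : ℝ := N * δ⁻¹ ^ (N - 1) * (δ⁻¹ * δ⁻¹)

theorem invPowLip_nonneg (N : ℕ) {δ : ℝ} (hδ : 0 < δ) : 0 ≤ invPowLip N δ := by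
  unfold invPowLip; positivity

variable {N : ℕ} {x₀ x : EuclideanSpace ℝ (Fin N)}

/-- The integrand of the correction term in the transformation formula. -/
noncomputable def correctionIntegrand (x₀ x z : EuclideanSpace ℝ (Fin N)) : ℝ :=
  ((‖z - x₀‖ ^ N)⁻¹ - (‖x - x₀‖ ^ N)⁻¹) / ‖z - x‖ ^ N

theorem abs_inv_pow_norm_sub_le {δ : ℝ} (hδ : 0 < δ) {x z : EuclideanSpace ℝ (Fin N)}
    (hz : δ ≤ ‖z - x₀‖) (hx : δ ≤ ‖x - x₀‖) :
    |(‖z - x₀‖ ^ N)⁻¹ - (‖x - x₀‖ ^ N)⁻¹| ≤ invPowLip N δ * ‖z - x‖ := by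
  refine (abs_inv_pow_sub_inv_pow_le N hδ hz hx).trans ?_
  have := abs_norm_sub_norm_le (z - x₀) (x - x₀)
  rw [sub_sub_sub_cancel_right] at this
  exact mul_le_mul_of_nonneg_left this (invPowLip_nonneg N hδ)

/-- The Lipschitz bound gains one power of `‖z - x‖`, making the singularity at `x` integrable. -/
theorem norm_correctionIntegrand_le {δ : ℝ} (hδ : 0 < δ) {z : EuclideanSpace ℝ (Fin N)}
    (hz : δ ≤ ‖z - x₀‖) (hx : δ ≤ ‖x - x₀‖) :
    ‖correctionIntegrand x₀ x z‖ ≤ invPowLip N δ * (‖z - x‖ / ‖z - x‖ ^ N) := by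
  rw [correctionIntegrand, norm_div, Real.norm_of_nonneg (by positivity : 0 ≤ ‖z - x‖ ^ N),
    ← mul_div_assoc, Real.norm_eq_abs]
  gcongr
  exact abs_inv_pow_norm_sub_le hδ hz hx

variable [NeZero N] {D : Set (EuclideanSpace ℝ (Fin N))}

theorem integrableOn_correctionIntegrand {δ r : ℝ} (hδ : 0 < δ) (hD : MeasurableSet D)
    (hDr : D ⊆ ball x r) (hz : ∀ z ∈ D, δ ≤ ‖z - x₀‖) (hx : δ ≤ ‖x - x₀‖) :
    IntegrableOn (correctionIntegrand x₀ x) D := by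
  refine Integrable.mono' (((integrableOn_ball_norm_div_pow x r).mono_set hDr).const_mul
    (invPowLip N δ)) (Measurable.aestronglyMeasurable (by unfold correctionIntegrand; fun_prop)) ?_
  filter_upwards [ae_restrict_mem hD] with z hzD
  exact norm_correctionIntegrand_le hδ (hz z hzD) hx

theorem abs_setIntegral_correctionIntegrand_le {δ r : ℝ} (hδ : 0 < δ) (hD : MeasurableSet D)
    (hDr : D ⊆ ball x r) (hz : ∀ z ∈ D, δ ≤ ‖z - x₀‖) (hx : δ ≤ ‖x - x₀‖) :
    |∫ z in D, correctionIntegrand x₀ x z| ≤ invPowLip N δ * kernelMass N r := by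
  have hint := (integrableOn_ball_norm_div_pow x r).const_mul (invPowLip N δ)
  calc |∫ z in D, correctionIntegrand x₀ x z|
      ≤ ∫ z in D, invPowLip N δ * (‖z - x‖ / ‖z - x‖ ^ N) := by
        rw [← Real.norm_eq_abs]
        refine norm_integral_le_of_norm_le (hint.mono_measure (Measure.restrict_mono_set _ hDr)) ?_
        filter_upwards [ae_restrict_mem hD] with z hzD
        exact norm_correctionIntegrand_le hδ (hz z hzD) hx
    _ ≤ ∫ z in ball x r, invPowLip N δ * (‖z - x‖ / ‖z - x‖ ^ N) := by
        refine setIntegral_mono_set hint (.of_forall fun z => ?_) hDr.eventuallyLE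
        have := invPowLip_nonneg N hδ
        show 0 ≤ _
        positivity
    _ = _ := by rw [integral_const_mul, setIntegral_ball_norm_div_pow]

end Lipschitz

/-! ### Transport of the integrand by inversion -/

section Transfer

variable {N : ℕ} {x₀ x z : EuclideanSpace ℝ (Fin N)} {R : ℝ}
  {u : EuclideanSpace ℝ (Fin N) → ℝ} {D : Set (EuclideanSpace ℝ (Fin N))}

theorem norm_inversion_sub_center (x₀ x : EuclideanSpace ℝ (Fin N)) (R : ℝ) :
    ‖inversion x₀ R x - x₀‖ = R ^ 2 / ‖x - x₀‖ := by
  rw [← dist_eq_norm, dist_inversion_center, dist_eq_norm]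

theorem norm_inversion_sub_inversion (hx : x ≠ x₀) (hz : z ≠ x₀) :
    ‖inversion x₀ R x - inversion x₀ R z‖ = R ^ 2 / (‖x - x₀‖ * ‖z - x₀‖) * ‖x - z‖ := by
  rw [← dist_eq_norm, dist_inversion_inversion hx hz, dist_eq_norm, dist_eq_norm, dist_eq_norm]

theorem kelvin_inversion (hR : 0 < R) (u : EuclideanSpace ℝ (Fin N) → ℝ) :
    kelvin x₀ R u (inversion x₀ R x) = (‖inversion x₀ R x - x₀‖ ^ N)⁻¹ * u x := by
  rw [kelvin, inversion_inversion x₀ hR.ne']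

/-- Jacobian and distance formula turn the kernel into `(|x - x₀| / |z - x₀|) ^ N / |x - z| ^ N`.
The weight of the Kelvin transform at `z*` cancels the quotient for `u z`; for `u x` the quotient
stays, and its deviation from `1` is the correction. -/
theorem jacobian_mul_logLapIntegrand_kelvin (hR : 0 < R) (hx : x ≠ x₀) (hz : z ≠ x₀) :
    (R / dist z x₀) ^ (2 * N) * logLapIntegrand (inversion x₀ R ⁻¹' D) (kelvin x₀ R u)
        (inversion x₀ R x) (inversion x₀ R z) =
      (‖inversion x₀ R x - x₀‖ ^ N)⁻¹ * (logLapIntegrand D u x z +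
        u x * ‖x - x₀‖ ^ N * D.indicator (correctionIntegrand x₀ x) z) := by
  have ha : ‖x - x₀‖ ^ N ≠ 0 := pow_ne_zero _ (norm_ne_zero_iff.2 (sub_ne_zero.2 hx))
  have hb : ‖z - x₀‖ ^ N ≠ 0 := pow_ne_zero _ (norm_ne_zero_iff.2 (sub_ne_zero.2 hz))
  have hr : (R ^ 2) ^ N ≠ 0 := by positivity
  have hmem : inversion x₀ R z ∈ inversion x₀ R ⁻¹' D ↔ z ∈ D := by
    rw [mem_preimage, inversion_inversion x₀ hR.ne']
  simp only [logLapIntegrand, correctionIntegrand, indicator, hmem, kelvin_inversion hR,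
    norm_inversion_sub_inversion hx hz, norm_inversion_sub_center, dist_eq_norm, div_pow, mul_pow,
    norm_sub_rev z x, pow_mul]
  rw [← pow_mul ‖z - x₀‖, mul_comm 2 N, pow_mul ‖z - x₀‖]
  simp only [div_eq_mul_inv _ (_ * _ : ℝ), div_eq_mul_inv _ (‖x - z‖ ^ N)]
  generalize ‖x - x₀‖ ^ N = a at *
  generalize ‖z - x₀‖ ^ N = b at *
  generalize (R ^ 2) ^ N = r at *
  rw [mul_inv _ (‖x - z‖ ^ N)]
  -- The case `z = x` is allowed, so this inverse must remain an opaque factor that is never cleared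
  -- as a denominator.
  generalize (‖x - z‖ ^ N)⁻¹ = d at *
  by_cases h : z ∈ D
  · simp only [hmem.2 h, h, if_true]
    field_simp
    ring
  · simp only [mt hmem.1 h, h, if_false]
    field_simp
    ring

variable [NeZero N]

theorem integrable_and_integral_logLapIntegrand_kelvin (hR : 0 < R) (hx : x ≠ x₀)
    (hD : MeasurableSet D) (hu : Integrable (logLapIntegrand D u x))
    (hK : IntegrableOn (correctionIntegrand x₀ x) D) :
    Integrable (logLapIntegrand (inversion x₀ R ⁻¹' D) (kelvin x₀ R u) (inversion x₀ R x)) ∧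
    ∫ y, logLapIntegrand (inversion x₀ R ⁻¹' D) (kelvin x₀ R u) (inversion x₀ R x) y =
      (‖inversion x₀ R x - x₀‖ ^ N)⁻¹ * ((∫ z, logLapIntegrand D u x z) +
        u x * ‖x - x₀‖ ^ N * ∫ z in D, correctionIntegrand x₀ x z) := by
  have hK' := ((integrable_indicator_iff hD).2 hK).const_mul (u x * ‖x - x₀‖ ^ N)
  have hae : ∀ᵐ z : EuclideanSpace ℝ (Fin N), z ≠ x₀ := by
    simp [ae_iff]
  have heq := hae.mono fun z hz =>
    jacobian_mul_logLapIntegrand_kelvin (u := u) (D := D) hR hx hz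
  constructor
  · rw [← integrable_inversion_iff hR, integrable_congr heq]
    exact (hu.add hK').const_mul _
  · rw [← integral_inversion hR, integral_congr_ae heq, integral_const_mul,
      integral_add hu hK', integral_const_mul, integral_indicator hD]

end Transfer

/-! ### Quantitative geometry of the inversion -/

section Geometry

variable {N : ℕ} {x₀ x : EuclideanSpace ℝ (Fin N)} {R : ℝ}
  {D : Set (EuclideanSpace ℝ (Fin N))}

theorem kelvinSet_eq_preimage (hR : 0 < R) (h : x₀ ∉ D) :
    kelvinSet x₀ R D = inversion x₀ R ⁻¹' D := by
  rw [kelvinSet, sdiff_singleton_eq_self h]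
  exact congrFun (image_eq_preimage_of_inverse (inversion_involutive x₀ hR.ne')
    (inversion_involutive x₀ hR.ne')) D

theorem norm_inversion_sub_center_le {δ : ℝ} (hδ : 0 < δ) (hx : δ ≤ ‖x - x₀‖) :
    ‖inversion x₀ R x - x₀‖ ≤ R ^ 2 / δ := by
  rw [norm_inversion_sub_center]
  gcongr

theorem preimage_inversion_subset_closedBall (hR : 0 < R) {δ : ℝ} (hδ : 0 < δ)
    (hD : ∀ z ∈ D, δ ≤ ‖z - x₀‖) :
    inversion x₀ R ⁻¹' D ⊆ closedBall x₀ (R ^ 2 / δ) := fun y hy => by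
  rw [mem_closedBall, dist_eq_norm, ← inversion_inversion x₀ hR.ne' y]
  exact norm_inversion_sub_center_le hδ (hD _ hy)

theorem preimage_inversion_subset_ball (hR : 0 < R) {δ : ℝ} (hδ : 0 < δ)
    (hD : ∀ z ∈ D, δ ≤ ‖z - x₀‖) (hx : δ ≤ ‖x - x₀‖) :
    inversion x₀ R ⁻¹' D ⊆ ball (inversion x₀ R x) (2 * (R ^ 2 / δ) + 1) := fun y hy => by
  have h1 := preimage_inversion_subset_closedBall hR hδ hD hy
  have h2 := norm_inversion_sub_center_le (R := R) hδ hx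
  rw [mem_closedBall] at h1
  rw [← dist_eq_norm] at h2
  rw [mem_ball]
  linarith [dist_triangle_right y (inversion x₀ R x) x₀]

/-- The radius of a ball around `x*` whose inversion lies in the ball of radius `ε` around `x`,
when `|x - x₀| ≤ M`. -/
noncomputable def inversionRadius (R M ε : ℝ) : ℝ :=
  min (R ^ 2 / (2 * M)) (ε * R ^ 2 / (2 * M ^ 2))

theorem inversionRadius_pos {M ε : ℝ} (hR : 0 < R) (hM : 0 < M) (hε : 0 < ε) :
    0 < inversionRadius R M ε := by
  unfold inversionRadius
  positivity

/-- The point `x*` is at distance at least `R² / M` from `x₀`, and moving by `r` loses at most half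
of that. -/
theorem norm_sub_center_ge_of_mem_ball {M r : ℝ} (hR : 0 < R) (hx : x ≠ x₀)
    (hxM : ‖x - x₀‖ ≤ M) (hr : r ≤ R ^ 2 / (2 * M)) {y : EuclideanSpace ℝ (Fin N)}
    (hy : ‖y - inversion x₀ R x‖ ≤ r) :
    R ^ 2 / (2 * M) ≤ ‖y - x₀‖ := by
  have ha : 0 < ‖x - x₀‖ := norm_pos_iff.2 (sub_ne_zero.2 hx)
  have h1 : R ^ 2 / M ≤ ‖inversion x₀ R x - x₀‖ := by
    rw [norm_inversion_sub_center]; gcongr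
  have h2 := norm_sub_le_norm_sub_add_norm_sub (inversion x₀ R x) y x₀
  rw [norm_sub_rev _ y] at h2
  have h3 : R ^ 2 / M = R ^ 2 / (2 * M) + R ^ 2 / (2 * M) := by
    have := ha.trans_le hxM
    field_simp; ring
  linarith

/-- Since `x = (x*)*`, the distance formula applies to `y` and `x*`, whose distances to `x₀` are at
least `R² / (2M)` and `R² / M`. -/
theorem norm_inversion_sub_le {M r : ℝ} (hR : 0 < R) (hx : x ≠ x₀) (hxM : ‖x - x₀‖ ≤ M)
    (hr : r ≤ R ^ 2 / (2 * M)) {y : EuclideanSpace ℝ (Fin N)}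
    (hy : ‖y - inversion x₀ R x‖ ≤ r) :
    ‖inversion x₀ R y - x‖ ≤ 2 * M ^ 2 / R ^ 2 * ‖y - inversion x₀ R x‖ := by
  have ha : 0 < ‖x - x₀‖ := norm_pos_iff.2 (sub_ne_zero.2 hx)
  have hM : 0 < M := ha.trans_le hxM
  have h1 := norm_sub_center_ge_of_mem_ball hR hx hxM hr hy
  have hpos : 0 < R ^ 2 / (2 * M) := by positivity
  have hy0 : y ≠ x₀ := by
    rintro rfl
    rw [sub_self, norm_zero] at h1
    linarith
  have hx' : inversion x₀ R x ≠ x₀ := fun h => hx ((inversion_eq_center hR.ne').1 h)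
  conv_lhs => rw [← inversion_inversion x₀ hR.ne' x]
  rw [norm_inversion_sub_inversion hy0 hx']
  refine mul_le_mul_of_nonneg_right ?_ (norm_nonneg _)
  calc R ^ 2 / (‖y - x₀‖ * ‖inversion x₀ R x - x₀‖)
      ≤ R ^ 2 / (R ^ 2 / (2 * M) * (R ^ 2 / M)) := by
        rw [norm_inversion_sub_center]
        gcongr
    _ = 2 * M ^ 2 / R ^ 2 := by field_simp

theorem ball_inversion_subset_preimage {M ε : ℝ} (hR : 0 < R) (hε : 0 < ε) (hx : x ≠ x₀)
    (hxM : ‖x - x₀‖ ≤ M) :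
    ball (inversion x₀ R x) (inversionRadius R M ε) ⊆ inversion x₀ R ⁻¹' ball x ε := by
  intro y hy
  have ha : 0 < ‖x - x₀‖ := norm_pos_iff.2 (sub_ne_zero.2 hx)
  have hM : 0 < M := ha.trans_le hxM
  rw [mem_ball, dist_eq_norm] at hy
  have h := norm_inversion_sub_le hR hx hxM (min_le_left _ _) hy.le
  have h2 : ‖y - inversion x₀ R x‖ < ε * R ^ 2 / (2 * M ^ 2) := hy.trans_le (min_le_right _ _)
  rw [mem_preimage, mem_ball, dist_eq_norm]
  refine h.trans_lt ?_
  calc 2 * M ^ 2 / R ^ 2 * ‖y - inversion x₀ R x‖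
      < 2 * M ^ 2 / R ^ 2 * (ε * R ^ 2 / (2 * M ^ 2)) := by gcongr
    _ = ε := by field_simp

end Geometry

/-! ### The transformation formula and its uniform bound -/

section Transformation

variable {N : ℕ} [NeZero N] {x₀ x : EuclideanSpace ℝ (Fin N)} {R : ℝ}
  {u : EuclideanSpace ℝ (Fin N) → ℝ} {D : Set (EuclideanSpace ℝ (Fin N))}

/-- The Kelvin transformation formula, localized to a bounded neighbourhood `D` of `x` that stays
away from the centre of the inversion. -/
theorem logLaplacian_kelvin (hR : 0 < R) (hD : MeasurableSet D) {r δ ε : ℝ}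
    (hDr : D ⊆ ball x r) (hδ : 0 < δ) (hDδ : ∀ z ∈ D, δ ≤ ‖z - x₀‖) (hε : 0 < ε)
    (hxD : ball x ε ⊆ D) (hu : LogLaplacianDefinedAt u x) :
    LogLaplacianDefinedAt (kelvin x₀ R u) (inversion x₀ R x) ∧
    logLaplacian (kelvin x₀ R u) (inversion x₀ R x) = (‖inversion x₀ R x - x₀‖ ^ N)⁻¹ *
      (logLaplacian u x + logLapC N * u x *
        (‖x - x₀‖ ^ N * (∫ z in D, correctionIntegrand x₀ x z)
        + (∫ y, kernelDiff (ball (inversion x₀ R x) 1) (inversion x₀ R ⁻¹' D) (inversion x₀ R x) y)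
        - ∫ y, kernelDiff (ball x 1) D x y)) := by
  have hxδ : δ ≤ ‖x - x₀‖ := hDδ x (hxD (mem_ball_self hε))
  have hx : x ≠ x₀ := by
    rintro rfl
    rw [sub_self, norm_zero] at hxδ
    linarith
  have hint := logLaplacianDefinedAt_iff.1 hu
  have hm : 0 < min ε 1 := by positivity
  have hDb : Bornology.IsBounded D := isBounded_ball.subset hDr
  have hBD : Integrable (kernelDiff (ball x 1) D x) :=
    integrable_kernelDiff measurableSet_ball isBounded_ball hD hDb hm
      (ball_subset_ball (min_le_right _ _)) ((ball_subset_ball (min_le_left _ _)).trans hxD)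
  have hGD_eq : ∀ y, logLapIntegrand D u x y =
      logLapIntegrand (ball x 1) u x y - u x * kernelDiff (ball x 1) D x y := fun y => by
    rw [logLapIntegrand_eq_add_kernelDiff (ball x 1) D]; ring
  have hGD : Integrable (logLapIntegrand D u x) :=
    (hint.sub (hBD.const_mul (u x))).congr (.of_forall fun y => (hGD_eq y).symm)
  have hGD_int : ∫ y, logLapIntegrand D u x y =
      (∫ y, logLapIntegrand (ball x 1) u x y) - u x * ∫ y, kernelDiff (ball x 1) D x y := by
    simp only [hGD_eq]
    rw [integral_sub hint (hBD.const_mul _), integral_const_mul]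
  obtain ⟨hT, hTint⟩ := integrable_and_integral_logLapIntegrand_kelvin (R := R) hR hx hD hGD
    (integrableOn_correctionIntegrand hδ hD hDr hDδ hxδ)
  set x' := inversion x₀ R x
  set A := inversion x₀ R ⁻¹' D
  have hr : 0 < inversionRadius R ‖x - x₀‖ ε :=
    inversionRadius_pos hR (norm_pos_iff.2 (sub_ne_zero.2 hx)) hε
  have hm' : 0 < min (inversionRadius R ‖x - x₀‖ ε) 1 := by positivity
  have hxA : ball x' (inversionRadius R ‖x - x₀‖ ε) ⊆ A :=
    (ball_inversion_subset_preimage hR hε hx le_rfl).trans (preimage_mono hxD)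
  have hBA : Integrable (kernelDiff (ball x' 1) A x') :=
    integrable_kernelDiff measurableSet_ball isBounded_ball (measurable_inversion hD)
      (isBounded_closedBall.subset (preimage_inversion_subset_closedBall hR hδ hDδ)) hm'
      (ball_subset_ball (min_le_right _ _)) ((ball_subset_ball (min_le_left _ _)).trans hxA)
  have hG := logLapIntegrand_eq_add_kernelDiff (u := kelvin x₀ R u) (ball x' 1) A x'
  have hdef : LogLaplacianDefinedAt (kelvin x₀ R u) x' := by
    rw [logLaplacianDefinedAt_iff]
    exact (hT.add (hBA.const_mul _)).congr (.of_forall fun y => (hG y).symm)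
  refine ⟨hdef, ?_⟩
  -- The `logLapRho` terms match without correction, because `u*(x*)` is `|x* - x₀| ^ (-N) u x`.
  rw [logLaplacian_eq hdef, logLaplacian_eq hu]
  simp only [hG]
  rw [integral_add hT (hBA.const_mul _), integral_const_mul, hTint, hGD_int, kelvin_inversion hR]
  ring

omit [NeZero N] in
theorem half_norm_le_of_mem_ball {δ : ℝ} {z : EuclideanSpace ℝ (Fin N)} (hδ : 2 * δ ≤ ‖x - x₀‖)
    (hz : z ∈ ball x δ) : δ ≤ ‖z - x₀‖ := by
  rw [mem_ball', dist_eq_norm] at hz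
  linarith [norm_sub_le_norm_sub_add_norm_sub x z x₀]

theorem logLaplacianDefinedAt_kelvin (hR : 0 < R) (hx : x ≠ x₀) (hu : LogLaplacianDefinedAt u x) :
    LogLaplacianDefinedAt (kelvin x₀ R u) (inversion x₀ R x) := by
  have ha : 0 < ‖x - x₀‖ / 2 := half_pos (norm_pos_iff.2 (sub_ne_zero.2 hx))
  exact (logLaplacian_kelvin hR measurableSet_ball subset_rfl ha
    (fun z hz => half_norm_le_of_mem_ball (x₀ := x₀) (x := x) (by linarith) hz) ha subset_rfl hu).1

theorem logLaplacian_kelvin_of_eq_zero (hR : 0 < R) (hx : x ≠ x₀)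
    (hu : LogLaplacianDefinedAt u x) (h0 : u x = 0) :
    logLaplacian (kelvin x₀ R u) (inversion x₀ R x) =
      (‖inversion x₀ R x - x₀‖ ^ N)⁻¹ * logLaplacian u x := by
  have ha : 0 < ‖x - x₀‖ / 2 := half_pos (norm_pos_iff.2 (sub_ne_zero.2 hx))
  have := (logLaplacian_kelvin hR measurableSet_ball subset_rfl ha
    (fun z hz => half_norm_le_of_mem_ball (x₀ := x₀) (x := x) (by linarith) hz) ha subset_rfl hu).2
  rw [this, h0]
  ring

omit [NeZero N] in
theorem exists_le_norm_sub_of_notMem_closure (h : x₀ ∉ closure D) :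
    ∃ δ > 0, ∀ z ∈ D, δ ≤ ‖z - x₀‖ := by
  rw [Metric.mem_closure_iff] at h
  push Not at h
  obtain ⟨δ, hδ, h⟩ := h
  exact ⟨δ, hδ, fun z hz => by rw [← dist_eq_norm, dist_comm]; exact h z hz⟩

theorem logLaplacian_kelvin_of_mem (hR : 0 < R) (hDo : IsOpen D) (hDb : Bornology.IsBounded D)
    (hx₀ : x₀ ∉ closure D) (hxD : x ∈ D) (hu : LogLaplacianDefinedAt u x) :
    logLaplacian (kelvin x₀ R u) (inversion x₀ R x) =
      (‖inversion x₀ R x - x₀‖ ^ N)⁻¹ * logLaplacian u x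
      + logLapC N * R ^ (2 * N) * (‖inversion x₀ R x - x₀‖ ^ (2 * N))⁻¹ * u x *
          (∫ z in D, correctionIntegrand x₀ x z)
      + (hFun (kelvinSet x₀ R D) (inversion x₀ R x) - hFun D x) *
          (‖inversion x₀ R x - x₀‖ ^ N)⁻¹ * u x := by
  obtain ⟨δ, hδ, hDδ⟩ := exists_le_norm_sub_of_notMem_closure hx₀
  obtain ⟨r, hr⟩ := hDb.subset_ball x
  obtain ⟨ε, hε, hε'⟩ := Metric.isOpen_iff.1 hDo x hxD
  have hx : x ≠ x₀ := fun h => hx₀ (h ▸ subset_closure hxD)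
  have ha : 0 < ‖x - x₀‖ := norm_pos_iff.2 (sub_ne_zero.2 hx)
  have hrad : 0 < inversionRadius R ‖x - x₀‖ ε := inversionRadius_pos hR ha hε
  rw [(logLaplacian_kelvin hR hDo.measurableSet hr hδ hDδ hε hε' hu).2,
    hFun_eq_integral_kernelDiff hDo.measurableSet hDb (ε := min ε 1) (by positivity)
      (min_le_right _ _) ((ball_subset_ball (min_le_left _ _)).trans hε'),
    kelvinSet_eq_preimage hR (fun h => hx₀ (subset_closure h)),
    hFun_eq_integral_kernelDiff (measurable_inversion hDo.measurableSet)
      (isBounded_closedBall.subset (preimage_inversion_subset_closedBall hR hδ hDδ))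
      (ε := min (inversionRadius R ‖x - x₀‖ ε) 1) (by positivity) (min_le_right _ _)
      ((ball_subset_ball (min_le_left _ _)).trans
        ((ball_inversion_subset_preimage hR hε hx le_rfl).trans (preimage_mono hε')))]
  -- This is `|x* - x₀| |x - x₀| = R²`, which puts the coefficient of the correction in the stated
  -- form.
  have hq : R ^ (2 * N) * (‖inversion x₀ R x - x₀‖ ^ (2 * N))⁻¹ =
      (‖inversion x₀ R x - x₀‖ ^ N)⁻¹ * ‖x - x₀‖ ^ N := by
    rw [norm_inversion_sub_center]
    simp only [div_pow, pow_mul]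
    rw [← pow_mul ‖x - x₀‖ 2, mul_comm 2 N, pow_mul ‖x - x₀‖, ← pow_mul (R ^ 2) 2, mul_comm 2 N,
      pow_mul (R ^ 2)]
    have h1 : ‖x - x₀‖ ^ N ≠ 0 := by positivity
    have h2 : (R ^ 2) ^ N ≠ 0 := by positivity
    field_simp
  rw [mul_assoc (logLapC N) (R ^ (2 * N)), hq]
  ring

/-- Uniformly for `R ≤ |x - x₀| ≤ M`, the logarithmic Laplacian of the Kelvin transform at `x*` is
controlled by that of `u` at `x`. -/
theorem exists_abs_logLaplacian_kelvin_le (hR : 0 < R) (M : ℝ)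
    (u : EuclideanSpace ℝ (Fin N) → ℝ) :
    ∃ C, 0 ≤ C ∧ ∀ x, R ≤ ‖x - x₀‖ → ‖x - x₀‖ ≤ M → LogLaplacianDefinedAt u x →
      |logLaplacian (kelvin x₀ R u) (inversion x₀ R x)| ≤ C * (|logLaplacian u x| + |u x|) := by
  rcases lt_or_ge M R with hMR | hMR
  · exact ⟨0, le_rfl, fun x h1 h2 => by linarith⟩
  have hM : 0 < M := hR.trans_le hMR
  -- With `D = ball x δ` and `R ≤ ‖x - x₀‖`, the set `D` stays `δ` away from `x₀`. Below, `K₃`,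
  -- `K₁`, `K₂` bound the correction integral and the kernel differences at `x*` and `x`, and `Q`
  -- bounds `|x* - x₀| ^ (-N)`.
  set δ := R / 2 with hδ_def
  have hδ : 0 < δ := half_pos hR
  set ε₁ := min (inversionRadius R M δ) 1
  have hε₁ : 0 < ε₁ := lt_min (inversionRadius_pos hR hM hδ) one_pos
  set ε₂ := min δ 1
  have hε₂ : 0 < ε₂ := lt_min hδ one_pos
  set C₁ := 2 * (R ^ 2 / δ) + 1
  have hC₁ : 1 ≤ C₁ := by
    have : 0 ≤ 2 * (R ^ 2 / δ) := by positivity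
    linarith
  set C₂ := max δ 1
  set K₁ := 1 / ε₁ ^ N * volume.real (ball (0 : EuclideanSpace ℝ (Fin N)) C₁)
  set K₂ := 1 / ε₂ ^ N * volume.real (ball (0 : EuclideanSpace ℝ (Fin N)) C₂)
  set K₃ := M ^ N * (invPowLip N δ * kernelMass N δ)
  set Q := (M / R ^ 2) ^ N
  set C := Q * (1 + |logLapC N| * (K₃ + K₁ + K₂))
  have hmass : 0 ≤ kernelMass N δ := integral_nonneg fun z => by
    show 0 ≤ _
    positivity
  have hlip := invPowLip_nonneg N hδ
  have hC : 0 ≤ C := by positivity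
  refine ⟨C, hC, fun x hxR hxM hu => ?_⟩
  have ha : 0 < ‖x - x₀‖ := hR.trans_le hxR
  have hx : x ≠ x₀ := sub_ne_zero.1 (norm_pos_iff.1 ha)
  have hDδ : ∀ z ∈ ball x δ, δ ≤ ‖z - x₀‖ := fun z hz =>
    half_norm_le_of_mem_ball (by linarith) hz
  rw [(logLaplacian_kelvin hR measurableSet_ball subset_rfl hδ hDδ hδ subset_rfl hu).2]
  have h3 : |‖x - x₀‖ ^ N * ∫ z in ball x δ, correctionIntegrand x₀ x z| ≤ K₃ := by
    rw [abs_mul, abs_of_pos (pow_pos ha N)]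
    have := abs_setIntegral_correctionIntegrand_le (x₀ := x₀) hδ (measurableSet_ball (x := x)
      (ε := δ)) subset_rfl hDδ (by linarith)
    exact mul_le_mul (pow_le_pow_left₀ ha.le hxM N) this (abs_nonneg _) (by positivity)
  have h1 := abs_integral_kernelDiff_le (x := inversion x₀ R x) hε₁
    (A := ball (inversion x₀ R x) 1) (B := inversion x₀ R ⁻¹' ball x δ)
    (ball_subset_ball (min_le_right _ _))
    ((ball_subset_ball (min_le_left _ _)).trans (ball_inversion_subset_preimage hR hδ hx hxM))
    (ball_subset_ball hC₁) (preimage_inversion_subset_ball hR hδ hDδ (by linarith))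
  have h2 := abs_integral_kernelDiff_le (x := x) hε₂
    (A := ball x 1) (B := ball x δ)
    (ball_subset_ball (min_le_right _ _)) (ball_subset_ball (min_le_left _ _))
    (ball_subset_ball (le_max_right δ 1)) (ball_subset_ball (le_max_left δ 1))
  have hq : |(‖inversion x₀ R x - x₀‖ ^ N)⁻¹| ≤ Q := by
    rw [norm_inversion_sub_center, ← inv_pow, inv_div, abs_of_pos (by positivity)]
    simp only [Q]
    gcongr
  rw [abs_mul]
  set T := ‖x - x₀‖ ^ N * (∫ z in ball x δ, correctionIntegrand x₀ x z)
        + (∫ y, kernelDiff (ball (inversion x₀ R x) 1) (inversion x₀ R ⁻¹' ball x δ)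
            (inversion x₀ R x) y)
        - ∫ y, kernelDiff (ball x 1) (ball x δ) x y
  have hT : |T| ≤ K₃ + K₁ + K₂ :=
    (abs_sub _ _).trans (add_le_add ((abs_add_le _ _).trans (add_le_add h3 h1)) h2)
  have hK : 0 ≤ K₃ + K₁ + K₂ := (abs_nonneg T).trans hT
  calc |(‖inversion x₀ R x - x₀‖ ^ N)⁻¹| * |logLaplacian u x + logLapC N * u x * T|
      ≤ Q * (|logLaplacian u x| + |logLapC N| * |u x| * (K₃ + K₁ + K₂)) := by
        have := abs_add_le (logLaplacian u x) (logLapC N * u x * T)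
        rw [abs_mul, abs_mul] at this
        refine mul_le_mul hq (this.trans ?_) (abs_nonneg _) (by positivity)
        gcongr
    _ ≤ C * (|logLaplacian u x| + |u x|) := by
        have h4 : 0 ≤ |logLapC N| * (K₃ + K₁ + K₂) := by positivity
        have h5 : 0 ≤ Q := by positivity
        have h6 : 0 ≤ Q * (|u x| + |logLapC N| * (K₃ + K₁ + K₂) * |logLaplacian u x|) := by
          positivity
        simp only [C]
        linarith

end Transformation

/-! ### Preservation of essential bounds -/

section Bounded

variable {N : ℕ} {x₀ : EuclideanSpace ℝ (Fin N)} {R : ℝ}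
  {u : EuclideanSpace ℝ (Fin N) → ℝ} {Ω : Set (EuclideanSpace ℝ (Fin N))}

theorem aestronglyMeasurable_logLaplacian (hu : AEMeasurable u) :
    AEStronglyMeasurable (logLaplacian u) := by
  have h1 : AEMeasurable (fun p : EuclideanSpace ℝ (Fin N) × EuclideanSpace ℝ (Fin N) =>
      (u p.1 - u p.2) / ‖p.1 - p.2‖ ^ N) (volume.prod volume) :=
    (hu.comp_fst.sub hu.comp_snd).div (Measurable.aemeasurable (by fun_prop))
  have h2 : AEMeasurable (fun p : EuclideanSpace ℝ (Fin N) × EuclideanSpace ℝ (Fin N) =>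
      u p.2 / ‖p.1 - p.2‖ ^ N) (volume.prod volume) :=
    hu.comp_snd.div (Measurable.aemeasurable (by fun_prop))
  have hs : MeasurableSet {p : EuclideanSpace ℝ (Fin N) × EuclideanSpace ℝ (Fin N) |
      p.2 ∈ ball p.1 1} := by
    simp only [mem_ball]
    exact measurableSet_lt (by fun_prop) (by fun_prop)
  have h3 := (h1.indicator hs).aestronglyMeasurable.integral_prod_right'
  have h4 := (h2.indicator hs.compl).aestronglyMeasurable.integral_prod_right'
  have h5 := ((h3.const_mul (logLapC N)).sub (h4.const_mul (logLapC N))).add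
    (hu.aestronglyMeasurable.const_mul (logLapRho N))
  refine h5.congr (.of_forall fun x => ?_)
  simp only [Pi.add_apply, Pi.sub_apply, logLaplacian]
  rw [← integral_indicator measurableSet_ball, ← integral_indicator measurableSet_ball.compl]
  rfl

variable [NeZero N]

theorem aemeasurable_kelvin (hR : 0 < R) (hu : AEMeasurable u) :
    AEMeasurable (kelvin x₀ R u) := by
  unfold kelvin
  exact (Measurable.aemeasurable (by fun_prop)).mul
    (hu.comp_quasiMeasurePreserving (quasiMeasurePreserving_inversion hR))

/-- In this form the weight is visibly bounded when `y*` stays in a bounded set. At `y = x₀` both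
sides are `0`, which uses `N ≠ 0`. -/
theorem inv_pow_norm_sub_center_eq (hR : 0 < R) (y : EuclideanSpace ℝ (Fin N)) :
    (‖y - x₀‖ ^ N)⁻¹ = (‖inversion x₀ R y - x₀‖ / R ^ 2) ^ N := by
  rw [norm_inversion_sub_center]
  rcases eq_or_ne (‖y - x₀‖) 0 with h | h
  · simp [h, NeZero.ne N]
  · rw [← inv_pow]
    congr 1
    field_simp

theorem abs_kelvin_le (hR : 0 < R) {M K : ℝ} {y : EuclideanSpace ℝ (Fin N)}
    (hM : ‖inversion x₀ R y - x₀‖ ≤ M) (hK : |u (inversion x₀ R y)| ≤ K) :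
    |kelvin x₀ R u y| ≤ (M / R ^ 2) ^ N * K := by
  have hM0 : 0 ≤ M := (norm_nonneg _).trans hM
  rw [kelvin, inv_pow_norm_sub_center_eq hR, abs_mul, abs_of_nonneg (by positivity)]
  gcongr

omit [NeZero N] in
theorem ae_bound_of_memLp_top {f : EuclideanSpace ℝ (Fin N) → ℝ}
    (hΩ : MeasurableSet Ω) (h : MemLp f ∞ (volume.restrict Ω)) :
    ∃ C, 0 ≤ C ∧ ∀ᵐ x, x ∈ Ω → |f x| ≤ C := by
  refine ⟨(eLpNorm f ∞ (volume.restrict Ω)).toReal, ENNReal.toReal_nonneg, ?_⟩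
  have h1 := ae_le_eLpNormEssSup (f := f) (μ := volume.restrict Ω)
  rw [ae_restrict_iff' hΩ] at h1
  filter_upwards [h1] with x hx hxΩ
  have := hx hxΩ
  rw [← eLpNorm_exponent_top] at this
  have h2 := ENNReal.toReal_mono h.2.ne this
  simpa using h2

theorem memLp_top_logLaplacian_kelvin (hR : 0 < R) (hΩ : MeasurableSet Ω)
    (hΩb : Bornology.IsBounded Ω) (hu : AEMeasurable u) (hΩR : ball x₀ R ⊆ Ωᶜ)
    (hbd : MemLp u ∞ (volume.restrict Ω))
    (hdef : ∀ᵐ x ∂(volume.restrict Ω), LogLaplacianDefinedAt u x)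
    (hL : MemLp (logLaplacian u) ∞ (volume.restrict Ω)) :
    MemLp (kelvin x₀ R u) ∞ (volume.restrict (kelvinSet x₀ R Ω)) ∧
    (∀ᵐ y ∂(volume.restrict (kelvinSet x₀ R Ω)), LogLaplacianDefinedAt (kelvin x₀ R u) y) ∧
    MemLp (logLaplacian (kelvin x₀ R u)) ∞ (volume.restrict (kelvinSet x₀ R Ω)) := by
  have hx₀ : x₀ ∉ Ω := hΩR (mem_ball_self hR)
  rw [kelvinSet_eq_preimage hR hx₀]
  have hm : MeasurableSet (inversion x₀ R ⁻¹' Ω) := measurable_inversion hΩ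
  obtain ⟨M, hM⟩ := hΩb.subset_closedBall x₀
  have hΩM : ∀ x ∈ Ω, ‖x - x₀‖ ≤ M := fun x hx => by
    rw [← dist_eq_norm]; exact hM hx
  have hΩR' : ∀ x ∈ Ω, R ≤ ‖x - x₀‖ := fun x hx => by
    by_contra hlt
    exact hΩR (by rwa [mem_ball, dist_eq_norm, ← not_le]) hx
  have hne : ∀ x ∈ Ω, x ≠ x₀ := fun x hx h => hx₀ (h ▸ hx)
  obtain ⟨K, hK, hKae⟩ := ae_bound_of_memLp_top hΩ hbd
  obtain ⟨K', hK', hKae'⟩ := ae_bound_of_memLp_top hΩ hL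
  rw [ae_restrict_iff' hΩ] at hdef
  have hdef' := ae_inversion (x₀ := x₀) hR hdef
  have hKa := ae_inversion (x₀ := x₀) hR hKae
  have hKa' := ae_inversion (x₀ := x₀) hR hKae'
  obtain ⟨C, hC, hbound⟩ := exists_abs_logLaplacian_kelvin_le (x₀ := x₀) hR M u
  have hku := aemeasurable_kelvin (x₀ := x₀) hR hu
  refine ⟨?_, ?_, ?_⟩
  · refine memLp_top_of_bound hku.aestronglyMeasurable.restrict ((M / R ^ 2) ^ N * K) ?_
    rw [ae_restrict_iff' hm]
    filter_upwards [hKa] with y hy hyΩ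
    exact abs_kelvin_le hR (hΩM _ hyΩ) (hy hyΩ)
  · rw [ae_restrict_iff' hm]
    filter_upwards [hdef'] with y hy hyΩ
    have := logLaplacianDefinedAt_kelvin hR (hne _ hyΩ) (hy hyΩ)
    rwa [inversion_inversion x₀ hR.ne'] at this
  · refine memLp_top_of_bound (aestronglyMeasurable_logLaplacian hku).restrict (C * (K' + K)) ?_
    rw [ae_restrict_iff' hm]
    filter_upwards [hdef', hKa, hKa'] with y hy h1 h2 hyΩ
    have := hbound _ (hΩR' _ hyΩ) (hΩM _ hyΩ) (hy hyΩ)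
    rw [inversion_inversion x₀ hR.ne'] at this
    refine this.trans ?_
    have h3 := h1 hyΩ
    have h4 := h2 hyΩ
    gcongr

end Bounded

/-! ### Dini continuity -/

section Dini

variable {N : ℕ} {x₀ x : EuclideanSpace ℝ (Fin N)} {R : ℝ}
  {u : EuclideanSpace ℝ (Fin N) → ℝ} {Ω : Set (EuclideanSpace ℝ (Fin N))}

theorem monotone_modulusAt (u : EuclideanSpace ℝ (Fin N) → ℝ) (x : EuclideanSpace ℝ (Fin N)) :
    Monotone (modulusAt u x univ) := fun _ _ h =>
  biSup_mono fun _ hy => ⟨hy.1, closedBall_subset_closedBall h hy.2⟩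

theorem ofReal_abs_sub_le_modulusAt {y : EuclideanSpace ℝ (Fin N)} {r : ℝ} (h : ‖y - x‖ ≤ r) :
    ENNReal.ofReal |u y - u x| ≤ modulusAt u x univ r :=
  le_iSup₂_of_le y ⟨mem_univ y, by rwa [mem_closedBall, dist_eq_norm]⟩ le_rfl

theorem exists_abs_le_of_modulusAt_lt_top (hΩ : Bornology.IsBounded Ω)
    (hu0 : ∀ x, x ∉ Ω → u x = 0) (h : ∀ r : ℝ, 0 < r → modulusAt u x univ r < ∞) :
    ∃ K, 0 ≤ K ∧ ∀ y, |u y| ≤ K := by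
  obtain ⟨r, hr⟩ := hΩ.subset_closedBall x
  -- The containing radius `r` may fail to be positive, while finiteness is known only for positive
  -- radii.
  have hlt := h (max r 1) (by positivity)
  refine ⟨|u x| + (modulusAt u x univ (max r 1)).toReal, by positivity, fun y => ?_⟩
  by_cases hy : y ∈ Ω
  · have h1 : ‖y - x‖ ≤ max r 1 := by
      rw [← dist_eq_norm]; exact (mem_closedBall.1 (hr hy)).trans (le_max_left _ _)
    have h2 := (ENNReal.ofReal_le_iff_le_toReal hlt.ne).1 (ofReal_abs_sub_le_modulusAt (u := u) h1)
    have h3 := abs_sub_abs_le_abs_sub (u y) (u x)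
    linarith
  · rw [hu0 y hy, abs_zero]
    positivity

variable [NeZero N]

/-- Near `x`, polar coordinates reduce the majorant `ω(|y - x|) / |y - x| ^ N` to the Dini integrand
`ω(t) / t`. Away from `x`, `u` is bounded with bounded support. -/
theorem DiniContinuousAt.logLaplacianDefinedAt (hΩ : MeasurableSet Ω)
    (hΩb : Bornology.IsBounded Ω) (hu : AEMeasurable u) (hu0 : ∀ x, x ∉ Ω → u x = 0)
    (h : DiniContinuousAt u univ x) : LogLaplacianDefinedAt u x := by
  obtain ⟨K, hK, hbd⟩ := exists_abs_le_of_modulusAt_lt_top hΩb hu0 h.1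
  have hmeas : Measurable (modulusAt u x univ) := (monotone_modulusAt u x).measurable
  constructor
  · have h1 : IntegrableOn (fun t => (modulusAt u x univ t / ENNReal.ofReal t).toReal)
        (Ioo 0 1) :=
      integrable_toReal_of_lintegral_ne_top (by fun_prop) h.2.ne
    have h2 : IntegrableOn (fun t => t ^ (N - 1) * ((modulusAt u x univ t).toReal / t ^ N))
        (Ioo 0 1) := by
      refine h1.congr_fun (fun t ht => ?_) measurableSet_Ioo
      have hN : N = N - 1 + 1 := (Nat.succ_pred (NeZero.ne N)).symm
      have ht0 : t ≠ 0 := ht.1.ne'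
      have hp : t ^ (N - 1) ≠ 0 := pow_ne_zero _ ht0
      have hpow : t ^ N = t ^ (N - 1) * t := by rw [← pow_succ, ← hN]
      simp only [ENNReal.toReal_div, ENNReal.toReal_ofReal ht.1.le, hpow]
      field_simp
    have h3 := integrableOn_ball_comp_norm_sub (f := fun t => (modulusAt u x univ t).toReal / t ^ N)
      x h2
    refine Integrable.mono' h3 ?_ ?_
    · exact ((aemeasurable_const.sub hu).div
        (Measurable.aemeasurable (by fun_prop))).aestronglyMeasurable.restrict
    · refine .of_forall fun y => ?_
      rw [norm_div, Real.norm_of_nonneg (by positivity : 0 ≤ ‖x - y‖ ^ N), norm_sub_rev x y,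
        Real.norm_eq_abs, abs_sub_comm]
      rcases eq_or_ne y x with rfl | hne
      · simp only [sub_self, abs_zero, norm_zero, zero_div]
        positivity
      · have hlt := h.1 _ (norm_pos_iff.2 (sub_ne_zero.2 hne))
        have := (ENNReal.ofReal_le_iff_le_toReal hlt.ne).1
          (ofReal_abs_sub_le_modulusAt (u := u) (x := x) (y := y) le_rfl)
        gcongr
  · have h1 := ((integrable_indicator_iff (hΩ.diff measurableSet_ball)).2
      (integrableOn_inv_pow_diff hΩ hΩb (measurableSet_ball (x := x) (ε := 1)) one_pos
        subset_rfl)).const_mul K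
    refine Integrable.mono' h1.restrict (hu.div
      (Measurable.aemeasurable (by fun_prop))).aestronglyMeasurable.restrict ?_
    filter_upwards [ae_restrict_mem measurableSet_ball.compl] with y hy
    by_cases hyΩ : y ∈ Ω
    · rw [indicator_of_mem (show y ∈ Ω \ ball x 1 from ⟨hyΩ, hy⟩), norm_div,
        Real.norm_of_nonneg (by positivity : 0 ≤ ‖x - y‖ ^ N), mul_one_div]
      gcongr
      exact hbd y
    · rw [hu0 y hyΩ, zero_div, norm_zero]
      exact mul_nonneg hK (indicator_nonneg (fun _ _ => by positivity) _)

omit [NeZero N] in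
theorem modulusAt_le_of_abs_le {v : EuclideanSpace ℝ (Fin N) → ℝ} {K : ℝ}
    (h : ∀ y, |v y| ≤ K) (x : EuclideanSpace ℝ (Fin N)) (r : ℝ) :
    modulusAt v x univ r ≤ ENNReal.ofReal (2 * K) := by
  refine iSup₂_le fun y _ => ENNReal.ofReal_le_ofReal ?_
  have := abs_sub (v y) (v x)
  linarith [h y, h x]

theorem lintegral_Ioo_comp_mul_left_le {g : ℝ → ℝ≥0∞} (hg : Measurable g) {Λ δ : ℝ} (hΛ : 0 < Λ)
    (hδ : Λ * δ ≤ 1) :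
    ∫⁻ r in Ioo 0 δ, g (Λ * r) ≤ ENNReal.ofReal |Λ⁻¹| * ∫⁻ s in Ioo (0 : ℝ) 1, g s := by
  have hgi : Measurable ((Ioo (0 : ℝ) 1).indicator g) := hg.indicator measurableSet_Ioo
  rw [← lintegral_indicator measurableSet_Ioo, ← lintegral_indicator measurableSet_Ioo,
    ← smul_eq_mul,
    ← lintegral_smul_measure, ← Real.map_volume_mul_left hΛ.ne',
    lintegral_map hgi (measurable_const_mul Λ)]
  refine lintegral_mono fun r => ?_
  by_cases hr : r ∈ Ioo 0 δ
  · have : Λ * r ∈ Ioo (0 : ℝ) 1 :=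
      ⟨mul_pos hΛ hr.1, (mul_lt_mul_of_pos_left hr.2 hΛ).trans_le hδ⟩
    rw [indicator_of_mem hr, indicator_of_mem this]
  · rw [indicator_of_notMem hr]
    exact zero_le

theorem exists_abs_kelvin_le (hR : 0 < R) (hΩ : Bornology.IsBounded Ω)
    (hu0 : ∀ x, x ∉ Ω → u x = 0) {K : ℝ} (hu : ∀ y, |u y| ≤ K) :
    ∃ C, ∀ y, |kelvin x₀ R u y| ≤ C := by
  obtain ⟨M, hM⟩ := hΩ.subset_closedBall x₀
  have hK : 0 ≤ K := (abs_nonneg _).trans (hu x₀)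
  refine ⟨(max M 0 / R ^ 2) ^ N * K, fun y => ?_⟩
  by_cases hy : inversion x₀ R y ∈ Ω
  · refine abs_kelvin_le hR ?_ (hu _)
    rw [← dist_eq_norm]
    exact (mem_closedBall.1 (hM hy)).trans (le_max_left _ _)
  · rw [kelvin, hu0 _ hy, mul_zero, abs_zero]
    positivity

theorem DiniContinuousAt.kelvin (hR : 0 < R) (hx : x ≠ x₀) (hΩb : Bornology.IsBounded Ω)
    (hu0 : ∀ x, x ∉ Ω → u x = 0) (h : DiniContinuousAt u univ x) :
    DiniContinuousAt (kelvin x₀ R u) univ (inversion x₀ R x) := by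
  obtain ⟨K, hK, hbd⟩ := exists_abs_le_of_modulusAt_lt_top hΩb hu0 h.1
  obtain ⟨C, hC⟩ := exists_abs_kelvin_le (x₀ := x₀) hR hΩb hu0 hbd
  have hmod := modulusAt_le_of_abs_le hC (inversion x₀ R x)
  refine ⟨fun r _ => (hmod r).trans_lt ENNReal.ofReal_lt_top, ?_⟩
  have ha : 0 < ‖x - x₀‖ := norm_pos_iff.2 (sub_ne_zero.2 hx)
  set a := ‖x - x₀‖
  set ρ := R ^ 2 / (2 * a)
  have hρ : 0 < ρ := by positivity
  set Λ := 2 * a ^ 2 / R ^ 2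
  have hΛ : 0 < Λ := by positivity
  -- Below `ρ` the weights are Lipschitz and the inversion expands distances to `x*` by at most `Λ`;
  -- below `Λ⁻¹` the rescaled radius `Λ * r` stays in the unit interval. On the remaining radii
  -- boundedness of `u*` suffices.
  set δ := min ρ Λ⁻¹
  have hδ : 0 < δ := by positivity
  have hΛδ : Λ * δ ≤ 1 := by
    calc Λ * δ ≤ Λ * Λ⁻¹ := by gcongr; exact min_le_right _ _
      _ = 1 := mul_inv_cancel₀ hΛ.ne'
  have hL := invPowLip_nonneg N hρ
  have hlocal : ∀ r ∈ Ioo 0 δ, modulusAt (_root_.kelvin x₀ R u) (inversion x₀ R x) univ r ≤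
      ENNReal.ofReal (ρ ^ N)⁻¹ * modulusAt u x univ (Λ * r) +
        ENNReal.ofReal (|u x| * invPowLip N ρ * r) := by
    intro r hr
    refine iSup₂_le fun y hy => ?_
    have hyr : ‖y - inversion x₀ R x‖ ≤ r := by
      rw [← dist_eq_norm]; exact mem_closedBall.1 hy.2
    have hrρ : r ≤ ρ := hr.2.le.trans (min_le_left _ _)
    have h1 : ρ ≤ ‖y - x₀‖ := norm_sub_center_ge_of_mem_ball hR hx le_rfl hrρ hyr
    have h2 : ρ ≤ ‖inversion x₀ R x - x₀‖ :=
      norm_sub_center_ge_of_mem_ball hR hx le_rfl hrρ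
        (by rw [sub_self, norm_zero]; exact hr.1.le)
    have h3 : ‖inversion x₀ R y - x‖ ≤ Λ * r :=
      (norm_inversion_sub_le hR hx le_rfl hrρ hyr).trans (by gcongr)
    have h4 := abs_inv_pow_norm_sub_le (N := N) hρ h1 h2
    have h5 : |_root_.kelvin x₀ R u y - _root_.kelvin x₀ R u (inversion x₀ R x)| ≤
        (ρ ^ N)⁻¹ * |u (inversion x₀ R y) - u x| + |u x| * invPowLip N ρ * r := by
      rw [kelvin_inversion hR, _root_.kelvin]
      have : (‖y - x₀‖ ^ N)⁻¹ * u (inversion x₀ R y) - (‖inversion x₀ R x - x₀‖ ^ N)⁻¹ * u x =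
          (‖y - x₀‖ ^ N)⁻¹ * (u (inversion x₀ R y) - u x) +
            u x * ((‖y - x₀‖ ^ N)⁻¹ - (‖inversion x₀ R x - x₀‖ ^ N)⁻¹) := by ring
      rw [this]
      refine (abs_add_le _ _).trans (add_le_add ?_ ?_)
      · rw [abs_mul, abs_of_nonneg (by positivity : 0 ≤ (‖y - x₀‖ ^ N)⁻¹)]
        gcongr
      · rw [abs_mul, mul_assoc]
        gcongr
        exact h4.trans (by gcongr)
    refine (ENNReal.ofReal_le_ofReal h5).trans ?_
    have hr0 := hr.1.le
    rw [ENNReal.ofReal_add (by positivity) (by positivity), ENNReal.ofReal_mul (by positivity)]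
    gcongr
    exact ofReal_abs_sub_le_modulusAt h3
  have hmeas : Measurable (modulusAt u x univ) := (monotone_modulusAt u x).measurable
  set g : ℝ → ℝ≥0∞ := fun s => modulusAt u x univ s / ENNReal.ofReal s with hg
  have hgm : Measurable g := by fun_prop
  have hsub : Ioo (0 : ℝ) 1 ⊆ Ioo 0 δ ∪ Ico δ 1 := fun r hr => by
    rcases lt_or_ge r δ with h | h
    · exact .inl ⟨hr.1, h⟩
    · exact .inr ⟨h, hr.2⟩
  refine (lintegral_mono_set hsub).trans_lt ((lintegral_union_le _ _ _).trans_lt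
    (ENNReal.add_lt_top.2 ⟨?_, ?_⟩))
  · calc ∫⁻ r in Ioo 0 δ, modulusAt (_root_.kelvin x₀ R u) (inversion x₀ R x) univ r /
          ENNReal.ofReal r
        ≤ ∫⁻ r in Ioo 0 δ, (ENNReal.ofReal (ρ ^ N)⁻¹ * (ENNReal.ofReal Λ * g (Λ * r)) +
          ENNReal.ofReal (|u x| * invPowLip N ρ)) := by
          refine setLIntegral_mono (by fun_prop) fun r hr => ?_
          have hr0 : ENNReal.ofReal r ≠ 0 := by simpa using hr.1
          refine (ENNReal.div_le_div_right (hlocal r hr) _).trans ?_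
          rw [ENNReal.add_div]
          refine add_le_add (le_of_eq ?_) (le_of_eq ?_)
          · simp only [hg, ENNReal.ofReal_mul hΛ.le]
            rw [mul_div_assoc]
            congr 1
            rw [mul_comm (ENNReal.ofReal Λ) (ENNReal.ofReal r), ← mul_div_assoc,
              mul_comm _ (modulusAt u x univ _),
              ENNReal.mul_div_mul_right _ _ (by simpa using hΛ) ENNReal.ofReal_ne_top]
          · rw [ENNReal.ofReal_mul (by positivity),
              ENNReal.mul_div_cancel_right hr0 ENNReal.ofReal_ne_top]
      _ = ENNReal.ofReal (ρ ^ N)⁻¹ * (ENNReal.ofReal Λ * ∫⁻ r in Ioo 0 δ, g (Λ * r)) +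
          ENNReal.ofReal (|u x| * invPowLip N ρ) * volume (Ioo 0 δ) := by
          rw [lintegral_add_right _ measurable_const, lintegral_const_mul _ (by fun_prop),
            lintegral_const_mul _ (by fun_prop), lintegral_const, Measure.restrict_apply_univ]
      _ < ∞ := by
          refine ENNReal.add_lt_top.2 ⟨ENNReal.mul_lt_top ENNReal.ofReal_lt_top
            (ENNReal.mul_lt_top ENNReal.ofReal_lt_top ?_),
            ENNReal.mul_lt_top ENNReal.ofReal_lt_top measure_Ioo_lt_top⟩
          exact (lintegral_Ioo_comp_mul_left_le hgm hΛ hΛδ).trans_lt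
            (ENNReal.mul_lt_top ENNReal.ofReal_lt_top h.2)
  · calc ∫⁻ r in Ico δ 1, modulusAt (_root_.kelvin x₀ R u) (inversion x₀ R x) univ r /
          ENNReal.ofReal r
        ≤ ∫⁻ r in Ico δ 1, ENNReal.ofReal (2 * C) / ENNReal.ofReal δ := by
          refine setLIntegral_mono measurable_const fun r hr => ?_
          exact ENNReal.div_le_div (hmod r) (ENNReal.ofReal_le_ofReal hr.1)
      _ < ∞ := by
          rw [lintegral_const, Measure.restrict_apply_univ]
          refine ENNReal.mul_lt_top (ENNReal.div_lt_top ENNReal.ofReal_ne_top ?_) measure_Ico_lt_top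
          simpa using hδ

end Dini

/-! ### The energy space -/

section Energy

variable {N : ℕ} {x₀ : EuclideanSpace ℝ (Fin N)} {R : ℝ}
  {u : EuclideanSpace ℝ (Fin N) → ℝ} {Ω : Set (EuclideanSpace ℝ (Fin N))}

/-- The quotient `|u x - u y| ^ 2 / |x - y| ^ N`. -/
noncomputable def energyQuotient (u : EuclideanSpace ℝ (Fin N) → ℝ)
    (x y : EuclideanSpace ℝ (Fin N)) : ℝ :=
  |u x - u y| ^ 2 / ‖x - y‖ ^ N

/-- After splitting `p s - q t` as `p (s - t) + (p - q) t`, the second term is Lipschitz-small and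
`t` is recovered from `u*(y) = q t`. The two Jacobians times the quotient of `u` give `R ^ (2N) p q
|s - t|² / |x - y| ^ N`; on the annulus `p ≤ (R' / ρ) ^ N q`, so `p²` is comparable to `p q`. -/
theorem energyQuotient_kelvin_le_of_norm_le {ρ R' : ℝ} (hR : 0 < R) (hρ : 0 < ρ)
    {x y : EuclideanSpace ℝ (Fin N)} (hx : ρ ≤ ‖x - x₀‖) (hy : ρ ≤ ‖y - x₀‖)
    (hx' : ‖x - x₀‖ ≤ R') (hy' : ‖y - x₀‖ ≤ R') (hxy : ‖x - y‖ ≤ 1) :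
    energyQuotient (kelvin x₀ R u) x y ≤
      2 * (invPowLip N ρ * R' ^ N) ^ 2 *
        (kelvin x₀ R u x ^ 2 + kelvin x₀ R u y ^ 2) * (‖x - y‖ / ‖x - y‖ ^ N) +
      2 * ((R' / ρ) ^ N * (R ^ (2 * N))⁻¹) *
        ((R / dist x x₀) ^ (2 * N) * ((R / dist y x₀) ^ (2 * N) *
          energyQuotient u (inversion x₀ R x) (inversion x₀ R y))) := by
  have ha : 0 < ‖x - x₀‖ := hρ.trans_le hx
  have hb : 0 < ‖y - x₀‖ := hρ.trans_le hy
  have hR' : 0 < R' := ha.trans_le hx'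
  have hx0 : x ≠ x₀ := sub_ne_zero.1 (norm_pos_iff.1 ha)
  have hy0 : y ≠ x₀ := sub_ne_zero.1 (norm_pos_iff.1 hb)
  have hL := invPowLip_nonneg N hρ
  set p := (‖x - x₀‖ ^ N)⁻¹
  set q := (‖y - x₀‖ ^ N)⁻¹
  set s := u (inversion x₀ R x)
  set t := u (inversion x₀ R y)
  have hvx : kelvin x₀ R u x = p * s := rfl
  have hvy : kelvin x₀ R u y = q * t := rfl
  have hpq : |p - q| ≤ invPowLip N ρ * ‖x - y‖ := abs_inv_pow_norm_sub_le hρ hx hy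
  have ht : |t| ≤ R' ^ N * |q * t| := by
    have h1 : t = ‖y - x₀‖ ^ N * (q * t) := by
      rw [← mul_assoc, mul_inv_cancel₀ (pow_pos hb N).ne', one_mul]
    calc |t| = ‖y - x₀‖ ^ N * |q * t| := by
          conv_lhs => rw [h1, abs_mul, abs_of_pos (pow_pos hb N)]
      _ ≤ _ := by gcongr
  have hpqt : |(p - q) * t| ≤ invPowLip N ρ * R' ^ N * |q * t| * ‖x - y‖ := by
    rw [abs_mul]
    calc |p - q| * |t| ≤ (invPowLip N ρ * ‖x - y‖) * (R' ^ N * |q * t|) := by gcongr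
      _ = _ := by ring
  have hsq : |p * s - q * t| ^ 2 ≤ 2 * p ^ 2 * |s - t| ^ 2 +
      2 * (invPowLip N ρ * R' ^ N) ^ 2 * ((p * s) ^ 2 + (q * t) ^ 2) * ‖x - y‖ ^ 2 := by
    have h1 : |(p - q) * t| ^ 2 ≤ (invPowLip N ρ * R' ^ N * |q * t| * ‖x - y‖) ^ 2 := by gcongr
    rw [sq_abs] at h1 ⊢
    rw [sq_abs]
    have h2 : (invPowLip N ρ * R' ^ N * |q * t| * ‖x - y‖) ^ 2 =
        (invPowLip N ρ * R' ^ N) ^ 2 * (q * t) ^ 2 * ‖x - y‖ ^ 2 := by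
      rw [mul_pow, mul_pow, sq_abs]
    have h3 : 0 ≤ (invPowLip N ρ * R' ^ N) ^ 2 * (p * s) ^ 2 * ‖x - y‖ ^ 2 := by positivity
    -- This yields `(α + β)² ≤ 2α² + 2β²` for the two terms of the splitting.
    have h4 := sq_nonneg (p * (s - t) - (p - q) * t)
    rw [h2] at h1
    linarith
  have hkernel : ‖x - y‖ ^ 2 / ‖x - y‖ ^ N ≤ ‖x - y‖ / ‖x - y‖ ^ N := by
    gcongr
    rw [sq]
    exact mul_le_of_le_one_left (norm_nonneg _) hxy
  have hjac : p ^ 2 * (|s - t| ^ 2 / ‖x - y‖ ^ N) ≤ ((R' / ρ) ^ N * (R ^ (2 * N))⁻¹) *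
        ((R / dist x x₀) ^ (2 * N) * ((R / dist y x₀) ^ (2 * N) *
          energyQuotient u (inversion x₀ R x) (inversion x₀ R y))) := by
    have heq : (R / dist x x₀) ^ (2 * N) * ((R / dist y x₀) ^ (2 * N) *
        energyQuotient u (inversion x₀ R x) (inversion x₀ R y)) =
        R ^ (2 * N) * p * q * (|s - t| ^ 2 / ‖x - y‖ ^ N) := by
      rw [energyQuotient, norm_inversion_sub_inversion hx0 hy0]
      simp only [dist_eq_norm, div_pow, mul_pow, pow_mul, p, q]
      rw [← pow_mul ‖x - x₀‖, mul_comm 2 N, pow_mul ‖x - x₀‖, ← pow_mul ‖y - x₀‖, mul_comm 2 N,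
        pow_mul ‖y - x₀‖]
      simp only [div_eq_mul_inv _ (_ * _ : ℝ), div_eq_mul_inv _ (‖x - y‖ ^ N)]
      rw [mul_inv _ (‖x - y‖ ^ N)]
      have h1 : ‖x - x₀‖ ^ N ≠ 0 := by positivity
      have h2 : ‖y - x₀‖ ^ N ≠ 0 := by positivity
      have h3 : (R ^ 2) ^ N ≠ 0 := by positivity
      generalize ‖x - x₀‖ ^ N = a at *
      generalize ‖y - x₀‖ ^ N = b at *
      generalize (R ^ 2) ^ N = r at *
      generalize (‖x - y‖ ^ N)⁻¹ = d at *
      field_simp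
      ring
    rw [heq]
    have hp : p ≤ (R' / ρ) ^ N * q := by
      simp only [p, q, ← inv_pow, ← mul_pow]
      gcongr
      calc ‖x - x₀‖⁻¹ ≤ ρ⁻¹ := by gcongr
        _ = R' / ρ * R'⁻¹ := by field_simp
        _ ≤ R' / ρ * ‖y - x₀‖⁻¹ := by gcongr
    have hRN : R ^ (2 * N) ≠ 0 := by positivity
    calc p ^ 2 * (|s - t| ^ 2 / ‖x - y‖ ^ N) = p * p * (|s - t| ^ 2 / ‖x - y‖ ^ N) := by ring
      _ ≤ ((R' / ρ) ^ N * q) * p * (|s - t| ^ 2 / ‖x - y‖ ^ N) := by gcongr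
      _ = _ := by field_simp
  calc energyQuotient (kelvin x₀ R u) x y = |p * s - q * t| ^ 2 / ‖x - y‖ ^ N := rfl
    _ ≤ (2 * p ^ 2 * |s - t| ^ 2 +
      2 * (invPowLip N ρ * R' ^ N) ^ 2 * ((p * s) ^ 2 + (q * t) ^ 2) * ‖x - y‖ ^ 2) /
        ‖x - y‖ ^ N := by gcongr
    _ = 2 * (invPowLip N ρ * R' ^ N) ^ 2 * ((p * s) ^ 2 + (q * t) ^ 2) *
          (‖x - y‖ ^ 2 / ‖x - y‖ ^ N) +
        2 * (p ^ 2 * (|s - t| ^ 2 / ‖x - y‖ ^ N)) := by ring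
    _ ≤ 2 * (invPowLip N ρ * R' ^ N) ^ 2 * ((p * s) ^ 2 + (q * t) ^ 2) *
          (‖x - y‖ / ‖x - y‖ ^ N) +
        2 * (((R' / ρ) ^ N * (R ^ (2 * N))⁻¹) *
          ((R / dist x x₀) ^ (2 * N) * ((R / dist y x₀) ^ (2 * N) *
            energyQuotient u (inversion x₀ R x) (inversion x₀ R y)))) := by gcongr
    _ = _ := by rw [hvx, hvy]; ring

theorem energyQuotient_le_of_le_norm {v : EuclideanSpace ℝ (Fin N) → ℝ} {ε : ℝ} (hε : 0 < ε)
    {x y : EuclideanSpace ℝ (Fin N)} (hxy : ε ≤ ‖x - y‖) :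
    energyQuotient v x y ≤ 2 / ε * (v x ^ 2 + v y ^ 2) * (‖x - y‖ / ‖x - y‖ ^ N) := by
  have hd : 0 < ‖x - y‖ := hε.trans_le hxy
  have h1 : |v x - v y| ^ 2 ≤ 2 * (v x ^ 2 + v y ^ 2) := by
    rw [sq_abs]
    linarith [sq_nonneg (v x + v y)]
  have h2 : 1 ≤ ‖x - y‖ / ε := (one_le_div hε).2 hxy
  calc energyQuotient v x y ≤ 2 * (v x ^ 2 + v y ^ 2) / ‖x - y‖ ^ N := by
        unfold energyQuotient; gcongr
    _ = 1 * (2 * (v x ^ 2 + v y ^ 2)) / ‖x - y‖ ^ N := by ring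
    _ ≤ (‖x - y‖ / ε) * (2 * (v x ^ 2 + v y ^ 2)) / ‖x - y‖ ^ N := by gcongr
    _ = _ := by ring

theorem norm_sub_center_mem_of_kelvin_ne_zero (hR : 0 < R) {M : ℝ}
    (hu : ∀ z, u z ≠ 0 → R ≤ ‖z - x₀‖ ∧ ‖z - x₀‖ ≤ M) {x : EuclideanSpace ℝ (Fin N)}
    (hx : kelvin x₀ R u x ≠ 0) : R ^ 2 / M ≤ ‖x - x₀‖ ∧ ‖x - x₀‖ ≤ R := by
  obtain ⟨h1, h2⟩ := hu _ (right_ne_zero_of_mul hx)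
  have h3 := norm_inversion_sub_center x₀ (inversion x₀ R x) R
  rw [inversion_inversion x₀ hR.ne'] at h3
  have hpos := hR.trans_le h1
  rw [h3]
  constructor
  · gcongr
  · rw [div_le_iff₀ hpos, sq]
    gcongr

/-- Pointwise control of the energy density of the Kelvin transform of a function supported in an
annulus. -/
theorem exists_energyQuotient_kelvin_le (hR : 0 < R) {M : ℝ} (hM : R ≤ M)
    (hu : ∀ z, u z ≠ 0 → R ≤ ‖z - x₀‖ ∧ ‖z - x₀‖ ≤ M) :
    ∃ C₁ C₂ : ℝ, 0 ≤ C₁ ∧ 0 ≤ C₂ ∧ ∀ x y, ‖x - y‖ ≤ 1 → energyQuotient (kelvin x₀ R u) x y ≤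
      C₁ * (kelvin x₀ R u x ^ 2 + kelvin x₀ R u y ^ 2) * (‖x - y‖ / ‖x - y‖ ^ N) +
      C₂ * ((R / dist x x₀) ^ (2 * N) * ((R / dist y x₀) ^ (2 * N) *
        (closedBall (inversion x₀ R x) 1).indicator (energyQuotient u (inversion x₀ R x))
          (inversion x₀ R y))) := by
  have hM0 : 0 < M := hR.trans_le hM
  set ρ := R ^ 2 / (2 * M)
  have hρ : 0 < ρ := by positivity
  have hρR : ρ ≤ R := by
    rw [div_le_iff₀ (by positivity), sq]
    gcongr
    linarith
  -- The transform lives in the annulus `2ρ ≤ |x - x₀| ≤ R`. If one of two points closer than `ρ`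
  -- lies there, both lie between `ρ` and `2R`. The second bound makes their inversions at most `1`
  -- apart, hence inside the range of the energy of `u`.
  set ε := min ρ (ρ ^ 2 / R ^ 2)
  have hε : 0 < ε := by positivity
  have hL := invPowLip_nonneg N hρ
  set A := 2 * (invPowLip N ρ * (2 * R) ^ N) ^ 2
  have hA : 0 ≤ A := by positivity
  set C₂ := 2 * ((2 * R / ρ) ^ N * (R ^ (2 * N))⁻¹)
  have hC₂ : 0 ≤ C₂ := by positivity
  refine ⟨2 / ε + A, C₂, by positivity, hC₂, fun x y hxy => ?_⟩
  set v := kelvin x₀ R u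
  have hE : ∀ z w : EuclideanSpace ℝ (Fin N), 0 ≤ energyQuotient u z w := fun z w => by
    unfold energyQuotient; positivity
  have hlast : 0 ≤ C₂ * ((R / dist x x₀) ^ (2 * N) * ((R / dist y x₀) ^ (2 * N) *
        (closedBall (inversion x₀ R x) 1).indicator (energyQuotient u (inversion x₀ R x))
          (inversion x₀ R y))) := by
    have := indicator_nonneg (s := closedBall (inversion x₀ R x) 1)
      (fun z _ => hE (inversion x₀ R x) z)
      (inversion x₀ R y)
    positivity
  have hk : 0 ≤ (v x ^ 2 + v y ^ 2) * (‖x - y‖ / ‖x - y‖ ^ N) := by positivity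
  rcases le_or_gt ε ‖x - y‖ with h | h
  · have h1 := energyQuotient_le_of_le_norm (v := v) hε h
    have h2 := mul_nonneg hA hk
    linarith
  · by_cases hxy0 : v x = 0 ∧ v y = 0
    · rw [energyQuotient, hxy0.1, hxy0.2]
      simpa using hlast
    have hdouble : R ^ 2 / M = 2 * ρ := by simp only [ρ]; field_simp
    have hlρ : ‖x - y‖ ≤ ρ := h.le.trans (min_le_left _ _)
    have hlρ' : ‖y - x‖ ≤ ρ := norm_sub_rev x y ▸ hlρ
    have h3 := norm_sub_le_norm_sub_add_norm_sub x y x₀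
    have h4 := norm_sub_le_norm_sub_add_norm_sub y x x₀
    have hann : (ρ ≤ ‖x - x₀‖ ∧ ‖x - x₀‖ ≤ 2 * R) ∧ (ρ ≤ ‖y - x₀‖ ∧ ‖y - x₀‖ ≤ 2 * R) := by
      by_cases hvx : v x = 0
      · have hvy : v y ≠ 0 := fun h => hxy0 ⟨hvx, h⟩
        have := norm_sub_center_mem_of_kelvin_ne_zero hR hu hvy
        rw [hdouble] at this
        refine ⟨⟨?_, ?_⟩, ?_, ?_⟩ <;> linarith [this.1, this.2]
      · have := norm_sub_center_mem_of_kelvin_ne_zero hR hu hvx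
        rw [hdouble] at this
        refine ⟨⟨?_, ?_⟩, ?_, ?_⟩ <;> linarith [this.1, this.2]
    have hmem : inversion x₀ R y ∈ closedBall (inversion x₀ R x) 1 := by
      have hx0 : x ≠ x₀ := sub_ne_zero.1 (norm_pos_iff.1 (hρ.trans_le hann.1.1))
      have hy0 : y ≠ x₀ := sub_ne_zero.1 (norm_pos_iff.1 (hρ.trans_le hann.2.1))
      have ha := hann.1.1
      have hb := hann.2.1
      rw [mem_closedBall', dist_eq_norm, norm_inversion_sub_inversion hx0 hy0]
      calc R ^ 2 / (‖x - x₀‖ * ‖y - x₀‖) * ‖x - y‖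
          ≤ R ^ 2 / (ρ * ρ) * (ρ ^ 2 / R ^ 2) := by
            gcongr
            exact h.le.trans (min_le_right _ _)
        _ = 1 := by field_simp
    rw [indicator_of_mem hmem]
    have h5 := energyQuotient_kelvin_le_of_norm_le (u := u) hR hρ hann.1.1 hann.2.1 hann.1.2
      hann.2.2 hxy
    have h6 : 0 ≤ 2 / ε * ((v x ^ 2 + v y ^ 2) * (‖x - y‖ / ‖x - y‖ ^ N)) := by positivity
    refine h5.trans ?_
    linarith

variable [NeZero N]

/-- The Jacobian times the squared Kelvin weight is the constant `R ^ (-2N)`, so the transform is a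
multiple of an `L²` isometry. -/
theorem memLp_two_kelvin (hR : 0 < R) (hu : MemLp u 2) : MemLp (kelvin x₀ R u) 2 := by
  have hm := (aemeasurable_kelvin (x₀ := x₀) hR hu.1.aemeasurable).aestronglyMeasurable
  rw [memLp_two_iff_integrable_sq hm, ← integrable_inversion_iff (x₀ := x₀) hR]
  have hint := ((memLp_two_iff_integrable_sq hu.1).1 hu).const_mul (R ^ (2 * N))⁻¹
  refine hint.congr ?_
  have hae : ∀ᵐ z : EuclideanSpace ℝ (Fin N), z ≠ x₀ := by simp [ae_iff]
  filter_upwards [hae] with z hz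
  have hb : ‖z - x₀‖ ≠ 0 := norm_ne_zero_iff.2 (sub_ne_zero.2 hz)
  rw [kelvin_inversion hR, norm_inversion_sub_center, dist_eq_norm]
  simp only [div_pow, mul_pow, pow_mul]
  rw [← pow_mul ‖z - x₀‖, mul_comm 2 N, pow_mul ‖z - x₀‖]
  have h1 : ‖z - x₀‖ ^ N ≠ 0 := by positivity
  have h2 : (R ^ 2) ^ N ≠ 0 := by positivity
  field_simp

/-- The truncated kernel `|z| / |z| ^ N` on the unit ball. -/
noncomputable def truncatedKernel (N : ℕ) (z : EuclideanSpace ℝ (Fin N)) : ℝ≥0∞ :=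
  (closedBall 0 1).indicator (fun z => ENNReal.ofReal (‖z‖ / ‖z‖ ^ N)) z

omit [NeZero N] in
theorem measurable_truncatedKernel : Measurable (truncatedKernel N) := by
  refine Measurable.indicator ?_ measurableSet_closedBall
  fun_prop

theorem lintegral_truncatedKernel_lt_top : ∫⁻ z, truncatedKernel N z < ∞ := by
  have h := (integrableOn_ball_norm_div_pow (0 : EuclideanSpace ℝ (Fin N)) 2).mono_set
    (closedBall_subset_ball one_lt_two)
  simp only [sub_zero] at h
  simp only [truncatedKernel]
  rw [lintegral_indicator measurableSet_closedBall]
  exact h.lintegral_lt_top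

omit [NeZero N] in
-- Tonelli and translation invariance. Splitting a sum needs measurability of one summand only, so
-- `G` is arbitrary; it will be the transported energy density.
theorem lintegral_lintegral_kernel_add {f κ : EuclideanSpace ℝ (Fin N) → ℝ≥0∞}
    (hf : AEMeasurable f) (hκ : Measurable κ)
    (G : EuclideanSpace ℝ (Fin N) → EuclideanSpace ℝ (Fin N) → ℝ≥0∞) :
    ∫⁻ x, ∫⁻ y, (f x * κ (x - y) + (f y * κ (x - y) + G x y)) =
      (∫⁻ x, f x) * (∫⁻ z, κ z) + ((∫⁻ x, f x) * (∫⁻ z, κ z) + ∫⁻ x, ∫⁻ y, G x y) := by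
  have hl : ∀ x, Measurable fun y => κ (x - y) := fun x => hκ.comp (measurable_id.const_sub x)
  have hr : ∀ y, Measurable fun x => κ (x - y) := fun y => hκ.comp (measurable_id.sub_const y)
  have hI₂ : AEMeasurable (fun p : EuclideanSpace ℝ (Fin N) × EuclideanSpace ℝ (Fin N) =>
      f p.2 * κ (p.1 - p.2)) (volume.prod volume) :=
    hf.comp_snd.mul (hκ.comp (measurable_fst.sub measurable_snd)).aemeasurable
  have hI₁ : ∀ x, ∫⁻ y, f x * κ (x - y) = f x * ∫⁻ z, κ z := fun x => by
    rw [lintegral_const_mul _ (hl x), lintegral_sub_left_eq_self κ x]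
  calc _ = ∫⁻ x, (f x * (∫⁻ z, κ z) + ((∫⁻ y, f y * κ (x - y)) + ∫⁻ y, G x y)) := by
        refine lintegral_congr fun x => ?_
        rw [lintegral_add_left ((hl x).const_mul _), hI₁,
          lintegral_add_left' (f := fun y => f y * κ (x - y)) (hf.mul (hl x).aemeasurable)]
    _ = (∫⁻ x, f x) * (∫⁻ z, κ z) +
          ((∫⁻ x, ∫⁻ y, f y * κ (x - y)) + ∫⁻ x, ∫⁻ y, G x y) := by
        rw [lintegral_add_left' (hf.mul_const _), lintegral_mul_const'' _ hf,
          lintegral_add_left' hI₂.lintegral_prod_right']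
    _ = _ := by
        rw [lintegral_lintegral_swap hI₂]
        congr 2
        rw [← lintegral_mul_const'' _ hf]
        refine lintegral_congr fun y => ?_
        rw [lintegral_const_mul _ (hr y), lintegral_sub_right_eq_self κ y]

theorem memH_kelvin (hR : 0 < R) (hΩb : Bornology.IsBounded Ω) (hΩR : ball x₀ R ⊆ Ωᶜ)
    (hu0 : ∀ x, x ∉ Ω → u x = 0) (h : MemH Ω u) :
    MemH (kelvinSet x₀ R Ω) (kelvin x₀ R u) := by
  have hx₀ : x₀ ∉ Ω := hΩR (mem_ball_self hR)
  have hv2 : MemLp (kelvin x₀ R u) 2 := memLp_two_kelvin hR h.1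
  refine ⟨hv2, ?_, ?_⟩
  swap
  · rw [kelvinSet_eq_preimage hR hx₀]
    refine .of_forall fun y hy => ?_
    rw [kelvin, hu0 _ hy, mul_zero]
  obtain ⟨M, hM⟩ := hΩb.subset_closedBall x₀
  have hsupp : ∀ z, u z ≠ 0 → R ≤ ‖z - x₀‖ ∧ ‖z - x₀‖ ≤ max M R := fun z hz => by
    have hzΩ : z ∈ Ω := by
      by_contra hc
      exact hz (hu0 z hc)
    refine ⟨?_, ?_⟩
    · by_contra hlt
      exact hΩR (by rwa [mem_ball, dist_eq_norm, ← not_le]) hzΩ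
    · rw [← dist_eq_norm]
      exact (mem_closedBall.1 (hM hzΩ)).trans (le_max_left _ _)
  obtain ⟨C₁, C₂, hC₁, hC₂, hle⟩ := exists_energyQuotient_kelvin_le hR (le_max_right M R) hsupp
  set v := kelvin x₀ R u with hv
  have hvm : AEMeasurable v := hv2.1.aemeasurable
  have hsq : AEMeasurable fun x => ENNReal.ofReal (C₁ * v x ^ 2) :=
    ((hvm.pow_const 2).const_mul C₁).ennreal_ofReal
  have hsqfin : ∫⁻ x, ENNReal.ofReal (C₁ * v x ^ 2) < ∞ :=
    (((memLp_two_iff_integrable_sq hv2.1).1 hv2).const_mul C₁).lintegral_lt_top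
  set κ := truncatedKernel N with hκ
  have hκm : Measurable κ := measurable_truncatedKernel
  have hκfin : ∫⁻ z, κ z < ∞ := lintegral_truncatedKernel_lt_top
  set J : EuclideanSpace ℝ (Fin N) → ℝ≥0∞ := fun x => ENNReal.ofReal ((R / dist x x₀) ^ (2 * N))
  set F : EuclideanSpace ℝ (Fin N) → EuclideanSpace ℝ (Fin N) → ℝ≥0∞ := fun z w =>
    (closedBall z 1).indicator (fun w => ENNReal.ofReal (energyQuotient u z w)) w with hF
  have hpt : ∀ x y, (closedBall x 1).indicator
      (fun y => ENNReal.ofReal (energyQuotient v x y)) y ≤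
      ENNReal.ofReal (C₁ * v x ^ 2) * κ (x - y) + (ENNReal.ofReal (C₁ * v y ^ 2) * κ (x - y) +
        ENNReal.ofReal C₂ * (J x * (J y * F (inversion x₀ R x) (inversion x₀ R y)))) := by
    intro x y
    by_cases hy : y ∈ closedBall x 1
    · have hxy : ‖x - y‖ ≤ 1 := by rwa [mem_closedBall', dist_eq_norm] at hy
      have hκxy : κ (x - y) = ENNReal.ofReal (‖x - y‖ / ‖x - y‖ ^ N) := by
        rw [hκ, truncatedKernel, indicator_of_mem (by simpa using hxy)]
      have hFxy : F (inversion x₀ R x) (inversion x₀ R y) = ENNReal.ofReal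
          ((closedBall (inversion x₀ R x) 1).indicator (energyQuotient u (inversion x₀ R x))
          (inversion x₀ R y)) := by
        simp only [hF, indicator]
        split_ifs <;> simp
      rw [indicator_of_mem hy, hκxy, hFxy, ← ENNReal.ofReal_mul (by positivity),
        ← ENNReal.ofReal_mul (by positivity), ← ENNReal.ofReal_mul (by positivity),
        ← ENNReal.ofReal_mul (by positivity), ← ENNReal.ofReal_mul hC₂]
      refine (ENNReal.ofReal_le_ofReal (hle x y hxy)).trans ?_
      have heq : ∀ T : ℝ, C₁ * (v x ^ 2 + v y ^ 2) * (‖x - y‖ / ‖x - y‖ ^ N) + T =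
        C₁ * v x ^ 2 * (‖x - y‖ / ‖x - y‖ ^ N) +
          (C₁ * v y ^ 2 * (‖x - y‖ / ‖x - y‖ ^ N) + T) := fun T => by ring
      rw [heq]
      exact ENNReal.ofReal_add_le.trans (by gcongr; exact ENNReal.ofReal_add_le)
    · rw [indicator_of_notMem hy]
      exact zero_le
  -- The change of variables in `y`, and later in `x`, returns the double integral of `u`; finite
  -- constants come out without measurability of `F`.
  have hI₃ : ∀ x, ∫⁻ y, ENNReal.ofReal C₂ *
      (J x * (J y * F (inversion x₀ R x) (inversion x₀ R y))) =
      ENNReal.ofReal C₂ * (J x * ∫⁻ w, F (inversion x₀ R x) w) := fun x => by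
    rw [lintegral_const_mul' _ _ ENNReal.ofReal_ne_top,
      lintegral_const_mul' _ _ ENNReal.ofReal_ne_top, lintegral_inversion hR]
  have hFfin : ∫⁻ z, ∫⁻ w, F z w < ∞ := by
    simp only [hF]
    simp_rw [lintegral_indicator measurableSet_closedBall]
    exact h.2.1
  calc ∫⁻ x, ∫⁻ y in closedBall x 1, ENNReal.ofReal (|v x - v y| ^ 2 / ‖x - y‖ ^ N)
      = ∫⁻ x, ∫⁻ y, (closedBall x 1).indicator
          (fun y => ENNReal.ofReal (energyQuotient v x y)) y := by
        simp_rw [lintegral_indicator measurableSet_closedBall]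
        rfl
    _ ≤ ∫⁻ x, ∫⁻ y, (ENNReal.ofReal (C₁ * v x ^ 2) * κ (x - y) +
          (ENNReal.ofReal (C₁ * v y ^ 2) * κ (x - y) +
          ENNReal.ofReal C₂ * (J x * (J y * F (inversion x₀ R x) (inversion x₀ R y))))) :=
        lintegral_mono fun x => lintegral_mono fun y => hpt x y
    _ = (∫⁻ x, ENNReal.ofReal (C₁ * v x ^ 2)) * (∫⁻ z, κ z) +
          ((∫⁻ x, ENNReal.ofReal (C₁ * v x ^ 2)) * (∫⁻ z, κ z) +
          ENNReal.ofReal C₂ * ∫⁻ z, ∫⁻ w, F z w) := by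
        rw [lintegral_lintegral_kernel_add hsq hκm]
        simp_rw [hI₃]
        rw [lintegral_const_mul' _ _ ENNReal.ofReal_ne_top,
          lintegral_inversion hR fun z => ∫⁻ w, F z w]
    _ < ∞ := ENNReal.add_lt_top.2 ⟨ENNReal.mul_lt_top hsqfin hκfin,
        ENNReal.add_lt_top.2 ⟨ENNReal.mul_lt_top hsqfin hκfin,
          ENNReal.mul_lt_top ENNReal.ofReal_lt_top hFfin⟩⟩

end Energy

/-! ### Convergence of the correction terms -/

section CorrectionTerms

variable {N : ℕ} [NeZero N] {x₀ x : EuclideanSpace ℝ (Fin N)} {R : ℝ}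
  {Ω : Set (EuclideanSpace ℝ (Fin N))}

theorem integrableOn_correctionIntegrand_of_notMem_closure (hΩ : MeasurableSet Ω)
    (hΩb : Bornology.IsBounded Ω) (hx : x ≠ x₀) (hx₀ : x₀ ∉ closure Ω) :
    IntegrableOn (correctionIntegrand x₀ x) Ω := by
  obtain ⟨δ, hδ, hΩδ⟩ := exists_le_norm_sub_of_notMem_closure hx₀
  obtain ⟨r, hr⟩ := hΩb.subset_ball x
  have ha : 0 < ‖x - x₀‖ := norm_pos_iff.2 (sub_ne_zero.2 hx)
  exact integrableOn_correctionIntegrand (lt_min hδ ha) hΩ hr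
    (fun z hz => (min_le_left _ _).trans (hΩδ z hz)) (min_le_right _ _)

omit [NeZero N] in
theorem hFunDefinedAt_of_ball_subset (hΩ : MeasurableSet Ω) (hΩb : Bornology.IsBounded Ω)
    {ε : ℝ} (hε : 0 < ε) (h : ball x ε ⊆ Ω) : HFunDefinedAt Ω x :=
  ⟨integrableOn_inv_pow_diff measurableSet_ball isBounded_ball hΩ hε h,
    integrableOn_inv_pow_diff hΩ hΩb measurableSet_ball one_pos subset_rfl⟩

omit [NeZero N] in
theorem hFunDefinedAt_kelvinSet (hR : 0 < R) (hΩo : IsOpen Ω) (hx₀ : x₀ ∉ closure Ω)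
    (hx : x ∈ Ω) : HFunDefinedAt (kelvinSet x₀ R Ω) (inversion x₀ R x) := by
  obtain ⟨δ, hδ, hΩδ⟩ := exists_le_norm_sub_of_notMem_closure hx₀
  obtain ⟨ε, hε, hε'⟩ := Metric.isOpen_iff.1 hΩo x hx
  have hne : x ≠ x₀ := fun h => hx₀ (h ▸ subset_closure hx)
  rw [kelvinSet_eq_preimage hR fun h => hx₀ (subset_closure h)]
  exact hFunDefinedAt_of_ball_subset (measurable_inversion hΩo.measurableSet)
    (isBounded_closedBall.subset (preimage_inversion_subset_closedBall hR hδ hΩδ))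
    (inversionRadius_pos hR (norm_pos_iff.2 (sub_ne_zero.2 hne)) hε)
    ((ball_inversion_subset_preimage hR hε hne le_rfl).trans (preimage_mono hε'))

end CorrectionTerms

/-! ### Assembly of the proposition -/

theorem proposition1p3 (N : ℕ) (hN : 1 ≤ N)
    (x₀ : EuclideanSpace ℝ (Fin N)) (R : ℝ) (hR : 0 < R)
    (Ω : Set (EuclideanSpace ℝ (Fin N))) (hΩo : IsOpen Ω) (hΩb : Bornology.IsBounded Ω)
    (u : EuclideanSpace ℝ (Fin N) → ℝ) (hu : AEMeasurable u volume)
    (hu0 : ∀ x, x ∉ Ω → u x = 0) :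
    -- (i) Dini continuity is preserved, and it makes the logarithmic Laplacian well defined
    (∀ x, x ≠ x₀ → DiniContinuousAt u univ x →
      DiniContinuousAt (kelvin x₀ R u) univ (EuclideanGeometry.inversion x₀ R x) ∧
      LogLaplacianDefinedAt u x) ∧
    -- (i) the transformation formula, wherever the logarithmic Laplacian of `u` is well defined
    (∀ x, x ≠ x₀ → LogLaplacianDefinedAt u x →
      LogLaplacianDefinedAt (kelvin x₀ R u) (EuclideanGeometry.inversion x₀ R x) ∧
      (x₀ ∉ closure Ω ∨ u x = 0 →
        logLaplacian (kelvin x₀ R u) (EuclideanGeometry.inversion x₀ R x) =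
          (‖EuclideanGeometry.inversion x₀ R x - x₀‖ ^ N)⁻¹ * logLaplacian u x
          + logLapC N * R ^ (2 * N) *
              (‖EuclideanGeometry.inversion x₀ R x - x₀‖ ^ (2 * N))⁻¹ * u x *
              (∫ z in Ω, ((‖z - x₀‖ ^ N)⁻¹ - (‖x - x₀‖ ^ N)⁻¹) / ‖z - x‖ ^ N)
          + (hFun (kelvinSet x₀ R Ω) (EuclideanGeometry.inversion x₀ R x) - hFun Ω x) *
              (‖EuclideanGeometry.inversion x₀ R x - x₀‖ ^ N)⁻¹ * u x)) ∧
    -- (i) the integrals in the correction terms converge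
    (∀ x, x ≠ x₀ → x₀ ∉ closure Ω →
      IntegrableOn (fun z => ((‖z - x₀‖ ^ N)⁻¹ - (‖x - x₀‖ ^ N)⁻¹) / ‖z - x‖ ^ N) Ω ∧
      (x ∈ Ω → HFunDefinedAt Ω x ∧
        HFunDefinedAt (kelvinSet x₀ R Ω) (EuclideanGeometry.inversion x₀ R x))) ∧
    -- (ii)
    (ball x₀ R ⊆ Ωᶜ →
      MemLp u ∞ (volume.restrict Ω) →
      (∀ᵐ x ∂(volume.restrict Ω), LogLaplacianDefinedAt u x) →
      MemLp (logLaplacian u) ∞ (volume.restrict Ω) →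
        MemLp (kelvin x₀ R u) ∞ (volume.restrict (kelvinSet x₀ R Ω)) ∧
        (∀ᵐ y ∂(volume.restrict (kelvinSet x₀ R Ω)), LogLaplacianDefinedAt (kelvin x₀ R u) y) ∧
        MemLp (logLaplacian (kelvin x₀ R u)) ∞ (volume.restrict (kelvinSet x₀ R Ω))) ∧
    -- (iii)
    (ball x₀ R ⊆ Ωᶜ → MemH Ω u → MemH (kelvinSet x₀ R Ω) (kelvin x₀ R u)) := by
  have : NeZero N := ⟨(Nat.one_le_iff_ne_zero.1 hN)⟩
  refine ⟨fun x hx hd => ⟨hd.kelvin hR hx hΩb hu0,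
      hd.logLaplacianDefinedAt hΩo.measurableSet hΩb hu hu0⟩,
    fun x hx hd => ⟨logLaplacianDefinedAt_kelvin hR hx hd, fun hor => ?_⟩,
    fun x hx hx₀ => ⟨integrableOn_correctionIntegrand_of_notMem_closure hΩo.measurableSet hΩb hx hx₀,
      fun hxΩ => ⟨?_, hFunDefinedAt_kelvinSet hR hΩo hx₀ hxΩ⟩⟩,
    fun hΩR hbd hdef hL =>
      memLp_top_logLaplacian_kelvin hR hΩo.measurableSet hΩb hu hΩR hbd hdef hL,
    fun hΩR hH => memH_kelvin hR hΩb hΩR hu0 hH⟩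
  · by_cases h0 : u x = 0
    · rw [logLaplacian_kelvin_of_eq_zero hR hx hd h0, h0]
      ring
    · have hxΩ : x ∈ Ω := by
        by_contra hc
        exact h0 (hu0 x hc)
      exact logLaplacian_kelvin_of_mem hR hΩo hΩb (hor.resolve_right h0) hxΩ hd
  · obtain ⟨ε, hε, hε'⟩ := Metric.isOpen_iff.1 hΩo x hxΩ
    exact hFunDefinedAt_of_ball_subset hΩo.measurableSet hΩb hε hε'
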